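/- Let $s\ge 0$, $c_1,\dots,c_s>0$, $z_1,\dots,z_s\in\mathbb R$, $\rho=\sum_{i=1}^s c_i\delta_{z_i}$ and $c=\rho(\mathbb R)=\sum_i c_i$. Then the weak limits $$p_\rho=\lim_{n\to\infty}\left(\left(1-\frac cn\right)\delta_0+\frac1n\rho\right)^{*n},\qquad \pi_\rho=\lim_{n\to\infty}\left(\left(1-\frac cn\right)\delta_0+\frac1n\rho\right)^{\boxplus n}\qquad(n\ge \max(1,c))$$ exist and are (uniquely determined) probability measures on $\mathbb R$, called the compound Poisson law and the compound free Poisson law of $\rho$. Here $*$ is the usual convolution and $\mu^{\boxplus n}$ is the free convolution power of a compactly supported probability measure $\mu$, that is, the law of a sum of $n$ free self-adjoint variables of law $\mu$ in a $C^*$-algebra with a state. Moreover: (1) The Fourier transform $F_{\mu}(y)=\int_{\mathbb R} e^{-iyx}\,d\mu(x)$ of $\mu=p_\rho$ is, for every $y\in\mathbb R$, $$F_{p_\rho}(y)=\exp\left(\sum_{i=1}^s c_i\left(e^{-iyz_i}-1\right)\right).$$ (2) $\pi_\rho$ is compactly supported, and its $R$-transform is, as a germ of analytic functions at $y=0$,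 $$R_{\pi_\rho}(y)=\sum_{i=1}^s\frac{c_iz_i}{1-yz_i}.$$ Here the $R$-transform of a compactly supported probability measure $\mu$ with moments $m_k=\int x^k\,d\mu(x)$ is the unique germ $R$ of analytic functions at $0$ such that $K(y)=R(y)+y^{-1}$ satisfies $G(K(y))=y$ for all small $y\ne0$, where $G(\xi)=\xi^{-1}f(\xi^{-1})$ for $|\xi|$ large and $f(y)=\sum_{k\ge0}m_ky^k$. -/

import Mathlib

open MeasureTheory Filter Topology
open scoped ENNReal

noncomputable section

/-- `μ` is carried by some compact subset of the real line. -/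
def IsCompactlySupported (μ : Measure ℝ) : Prop :=
  ∃ K : Set ℝ, IsCompact K ∧ μ Kᶜ = 0

/-! ### Free convolution -/

open scoped ComplexOrder in
/-- A state on a unital C⋆-algebra: a positive unital linear functional. The pair `(A, φ)` is then
a (C⋆-)noncommutative probability space. -/
def IsState {A : Type*} [CStarAlgebra A] (φ : A →ₗ[ℂ] ℂ) : Prop :=
  φ 1 = 1 ∧ ∀ x : A, 0 ≤ φ (star x * x)

/-- Voiculescu's freeness of a family `B` of unital subalgebras: `φ (x₁ ⋯ xₖ) = 0` whenever
`k ≥ 1`, `xⱼ ∈ B (iⱼ)`, `φ xⱼ = 0`, and consecutive indices `iⱼ`, `iⱼ₊₁` are different. The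
word `x₁ ⋯ xₖ` is given as the list of the pairs `(iⱼ, xⱼ)`. -/
def AreFree {A : Type*} [CStarAlgebra A] {ι : Type*} (φ : A →ₗ[ℂ] ℂ)
    (B : ι → Subalgebra ℂ A) : Prop :=
  ∀ w : List (ι × A), w ≠ [] →
    (∀ p ∈ w, p.2 ∈ B p.1 ∧ φ p.2 = 0) →
    w.IsChain (fun p q => p.1 ≠ q.1) →
    φ (w.map Prod.snd).prod = 0

/-- `μ` is the law (spectral distribution) of the variable `a` with respect to `φ`: the compactly
supported probability measure whose moments are the numbers `φ (a ^ k)`. -/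
def IsLawOf {A : Type*} [CStarAlgebra A] (φ : A →ₗ[ℂ] ℂ) (a : A) (μ : Measure ℝ) : Prop :=
  IsProbabilityMeasure μ ∧ IsCompactlySupported μ ∧
    ∀ k : ℕ, φ (a ^ k) = ((∫ x, x ^ k ∂μ : ℝ) : ℂ)

/-- `τ` is the free convolution of the measures `μ i`, `i : ι`: the law of the sum of free
self-adjoint variables `a i` having laws `μ i`. For a two-element `ι` this is `μ₁ ⊞ μ₂`. -/
def IsFreeConv {ι : Type} [Fintype ι] (μ : ι → Measure ℝ) (τ : Measure ℝ) : Prop :=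
  ∃ (A : Type) (_ : CStarAlgebra A) (φ : A →ₗ[ℂ] ℂ) (a : ι → A),
    IsState φ ∧ (∀ i, IsSelfAdjoint (a i)) ∧
    AreFree φ (fun i => Algebra.adjoin ℂ {a i}) ∧
    (∀ i, IsLawOf φ (a i) (μ i)) ∧ IsLawOf φ (∑ i, a i) τ

/-- `τ = μ ^ {⊞ n}`: the law of a sum of `n` free self-adjoint variables having law `μ`. -/
def IsFreeConvPow (μ : Measure ℝ) (n : ℕ) (τ : Measure ℝ) : Prop :=
  IsFreeConv (fun _ : Fin n => μ) τ

/-- The usual convolution power `μ ^ {* n}`. -/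
def convPow (μ : Measure ℝ) : ℕ → Measure ℝ
  | 0 => Measure.dirac 0
  | n + 1 => (convPow μ n).conv μ

/-! ### Compound Poisson and compound free Poisson laws -/

/-- The measure `(1 - c/n) δ₀ + (1/n) ρ` with `c = mass(ρ)`. It is the intended (probability)
measure as soon as `n ≥ 1` and `n ≥ c`; only large `n` matter below. -/
def poissonStep (ρ : Measure ℝ) (n : ℕ) : Measure ℝ :=
  ENNReal.ofReal (1 - ρ.real Set.univ / n) • Measure.dirac 0 + ENNReal.ofReal (1 / n) • ρ

/-- `p` is the compound Poisson law of `ρ`: the weak limit of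
`((1 - c/n) δ₀ + (1/n) ρ) ^ {* n}`. -/
def IsCompoundPoissonLaw (ρ : Measure ℝ) (p : ProbabilityMeasure ℝ) : Prop :=
  ∃ P : ℕ → ProbabilityMeasure ℝ,
    (∀ᶠ n in atTop, (P n : Measure ℝ) = convPow (poissonStep ρ n) n) ∧
    Tendsto P atTop (𝓝 p)

/-- `π` is the compound free Poisson law of `ρ`: the weak limit of
`((1 - c/n) δ₀ + (1/n) ρ) ^ {⊞ n}`. -/
def IsCompoundFreePoissonLaw (ρ : Measure ℝ) (π : ProbabilityMeasure ℝ) : Prop :=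
  ∃ P : ℕ → ProbabilityMeasure ℝ,
    (∀ᶠ n in atTop, IsFreeConvPow (poissonStep ρ n) n (P n : Measure ℝ)) ∧
    Tendsto P atTop (𝓝 π)

/-! ### Fourier transform and R-transform -/

/-- The Fourier transform, normalized so that the one of `δ_z` is `y ↦ exp (-i y z)`. -/
def fourierTransform (μ : Measure ℝ) (y : ℝ) : ℂ :=
  ∫ x : ℝ, Complex.exp (-Complex.I * y * x) ∂μ

/-- The moment generating function `f y = 1 + m₁ y + m₂ y² + ⋯` of a probability measure. -/
def momentGenFun (μ : Measure ℝ) (y : ℂ) : ℂ :=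
  ∑' k : ℕ, ((∫ x, x ^ k ∂μ : ℝ) : ℂ) * y ^ k

/-- The Cauchy transform `G ξ = ξ⁻¹ f (ξ⁻¹)`, for `ξ` near infinity. -/
def cauchyTransform (μ : Measure ℝ) (ξ : ℂ) : ℂ :=
  ξ⁻¹ * momentGenFun μ ξ⁻¹

/-- `R` is (a representative near `0` of) Voiculescu's R-transform of the compactly supported
measure `μ`: it is analytic at `0`, and `K y = R y + y⁻¹` satisfies `G (K y) = y` for all small
`y ≠ 0`. -/
def IsRTransform (μ : Measure ℝ) (R : ℂ → ℂ) : Prop :=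
  IsCompactlySupported μ ∧ AnalyticAt ℂ R 0 ∧
    ∀ᶠ y in 𝓝[≠] (0 : ℂ), cauchyTransform μ (R y + y⁻¹) = y

/-- The discrete measure `∑ i, c i δ_{z i}`. -/
def discreteMeasure {s : ℕ} (c z : Fin s → ℝ) : Measure ℝ :=
  ∑ i, ENNReal.ofReal (c i) • Measure.dirac (z i)

end

/-! Classical case: the step measure has characteristic function `1 + ψ(t)/n` with `ψ(t) = ∑ c_i
(e^{itz_i} - 1)`. Its `n`-th power tends to `e^ψ`, the characteristic function of `∑ z_i N_i` with
independent Poisson variables `N_i` of parameters `c_i`, so weak convergence follows.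

Free case: no R-transform calculus is used; moments are compared through one resolvent identity. Let
`S` be a sum of `n` free variables with common moment series `M`. Then `1 + n(M - 1) - X M S = 1 - ∑
w_i` with `w_i = 1 - M (1 - X a_i)`, and `(1 - w_i)⁻¹` has coefficientwise expectation `1`. Freeness
therefore gives the inverse of the whole expression expectation `1`
(`AreFree.apply_coeff_formalResolvent`). This is a unitriangular linear system for the moments of
`S`. For the Poisson step `n(M - 1) = w` does not depend on `n`, so only the factor `X M = X(1 +
w/n)` varies, and the system converges to the one with `X` in its place.

The limit system is solved by the moments of the bounded operator `∑ z_i (l_i + √c_i)(l_i + √c_i)⋆`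
on the full Fock space (`apply_fockResolvent`), whose law is compactly supported. Moment convergence
then gives weak convergence (`tendsto_of_tendsto_moment`). The same algebra, with a small complex
`t` in place of `X`, yields `f(t/e) = e` for `e = 1 + t R(t)`, which is the equation `G(R(t) + 1/t)
= t`.

Free convolution powers themselves are realised by matrices acting on a free product of Hilbert
spaces. -/

noncomputable section

/-! ### Partial permutation operators on `ℓ²` -/

/-- The Hilbert space of square summable families of complex numbers. -/
abbrev EllTwo (W : Type) : Type := lp (fun _ : W => ℂ) 2

section PartialPermutation

variable {W : Type}

/-- The function `w ↦ f (g w)`, extended by zero off the domain of `g`. -/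
def optComp (g : W ≃. W) (f : W → ℂ) (w : W) : ℂ := (g w).elim 0 f

/-- Since `g` is injective on its domain, reindexing by `v = g w` turns the left side into a sum of
distinct terms of `‖f‖²`. -/
lemma sum_norm_optComp_le (g : W ≃. W) (f : EllTwo W) (s : Finset W) :
    ∑ w ∈ s, ‖optComp g f w‖ ^ (2 : ℝ≥0∞).toReal ≤ ‖f‖ ^ (2 : ℝ≥0∞).toReal := by
  classical
  have h2 : 0 < (2 : ℝ≥0∞).toReal := by norm_num
  calc ∑ w ∈ s, ‖optComp g f w‖ ^ (2 : ℝ≥0∞).toReal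
      = ∑ w ∈ s with (g w).isSome, ‖optComp g f w‖ ^ (2 : ℝ≥0∞).toReal := by
        rw [Finset.sum_filter]
        refine Finset.sum_congr rfl fun w _ => ?_
        cases h : g w with
        | none => simp [optComp, h]
        | some v => simp [optComp]
    _ = ∑ v ∈ s.filterMap g (fun a a' b hb hb' => g.inj hb hb'),
          ‖f v‖ ^ (2 : ℝ≥0∞).toReal := by
        refine Finset.sum_bij' (fun w hw => (g w).get (Finset.mem_filter.1 hw).2)
          (fun v hv => (g.symm v).get ?_) ?_ ?_ ?_ ?_ ?_
        · obtain ⟨w, -, hw⟩ := Finset.mem_filterMap _ |>.1 hv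
          simp [g.eq_some_iff.2 hw]
        · intro w hw
          rw [Finset.mem_filterMap]
          exact ⟨w, (Finset.mem_filter.1 hw).1, by simp⟩
        · intro v hv
          obtain ⟨w, hws, hw⟩ := Finset.mem_filterMap _ |>.1 hv
          simp [g.eq_some_iff.2 hw, hws, hw]
        · intro w hw
          obtain ⟨v, hv⟩ := Option.isSome_iff_exists.1 (Finset.mem_filter.1 hw).2
          simp [hv, g.eq_some_iff.2 hv]
        · intro v hv
          obtain ⟨w, hws, hw⟩ := Finset.mem_filterMap _ |>.1 hv
          simp [g.eq_some_iff.2 hw, hw]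
        · intro w hw
          obtain ⟨v, hv⟩ := Option.isSome_iff_exists.1 (Finset.mem_filter.1 hw).2
          simp [optComp, hv]
    _ ≤ _ := lp.sum_rpow_le_norm_rpow h2 f _

/-- The partial isometry of `ℓ²(W)` given by composition with a partial permutation of `W`. -/
def partialPerm (g : W ≃. W) : EllTwo W →L[ℂ] EllTwo W :=
  LinearMap.mkContinuous
    { toFun := fun f => ⟨optComp g f, memℓp_gen' (sum_norm_optComp_le g f)⟩
      map_add' := fun f h => by
        ext w
        change (g w).elim (0 : ℂ) _ = (g w).elim (0 : ℂ) f + (g w).elim (0 : ℂ) h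
        cases g w
        · exact (add_zero 0).symm
        · rfl
      map_smul' := fun a f => by
        ext w
        change optComp g (⇑(a • f)) w = a * optComp g f w
        cases hw : g w <;> simp [optComp, hw] }
    1 fun f => by
      rw [one_mul]
      exact lp.norm_le_of_forall_sum_le (by norm_num) (norm_nonneg f) (sum_norm_optComp_le g f)

lemma partialPerm_apply (g : W ≃. W) (f : EllTwo W) (w : W) :
    partialPerm g f w = (g w).elim 0 f := rfl

/-- Coordinates of the adjoint are inner products with images of basis vectors, and the vector at
`w` is sent to the one at `v` if `g v = w`, and to `0` if there is no such `v`. -/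
lemma star_partialPerm (g : W ≃. W) : star (partialPerm g) = partialPerm g.symm := by
  classical
  ext f w
  have key : (star (partialPerm g) f) w = inner ℂ (partialPerm g (lp.single 2 w 1)) f := by
    rw [ContinuousLinearMap.star_eq_adjoint, ← ContinuousLinearMap.adjoint_inner_right,
      lp.inner_single_left]
    simp
  rw [key, partialPerm_apply]
  cases hw : g.symm w with
  | none =>
    have : partialPerm g (lp.single 2 w 1) = 0 := by
      ext v
      rw [partialPerm_apply]
      cases hv : g v with
      | none => simp
      | some u =>
        have : u ≠ w := by
          rintro rfl
          rw [g.eq_some_iff.2 hv] at hw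
          simp at hw
        simp [this]
    simp [this]
  | some v =>
    have : partialPerm g (lp.single 2 w 1) = lp.single 2 v 1 := by
      ext u
      rw [partialPerm_apply]
      have hvw := g.eq_some_iff.1 hw
      by_cases huv : u = v
      · subst huv
        simp [hvw]
      · cases hu : g u with
        | none => simp [huv]
        | some x =>
          have : x ≠ w := by
            rintro rfl
            exact huv (g.inj hu hvw)
          simp [this, huv]
    rw [this, lp.inner_single_left]
    simp

open Classical in
/-- The standard basis vector at `e`. -/
def basisVec (e : W) : EllTwo W := lp.single 2 e (1 : ℂ)

@[simp] lemma basisVec_self (e : W) : basisVec e e = 1 := by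
  classical exact lp.single_apply_self _ _ _

lemma basisVec_of_ne {e w : W} (h : w ≠ e) : basisVec e w = 0 := by
  classical exact lp.single_apply_ne _ _ _ h

lemma inner_basisVec (e : W) (f : EllTwo W) : inner ℂ (basisVec e) f = f e := by
  classical
  rw [basisVec, lp.inner_single_left]
  simp

/-- The vector state of the basis vector at `e`. -/
def vectorState (e : W) : (EllTwo W →L[ℂ] EllTwo W) →L[ℂ] ℂ :=
  (lp.evalCLM ℂ (fun _ : W => ℂ) 2 e).comp
    (ContinuousLinearMap.apply ℂ (EllTwo W) (basisVec e))

lemma vectorState_apply (e : W) (x : EllTwo W →L[ℂ] EllTwo W) :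
    vectorState e x = x (basisVec e) e := rfl

lemma vectorState_eq_inner (e : W) (x : EllTwo W →L[ℂ] EllTwo W) :
    vectorState e x = inner ℂ (basisVec e) (x (basisVec e)) := (inner_basisVec _ _).symm

open scoped ComplexOrder in
lemma isState_vectorState (e : W) : IsState (vectorState e).toLinearMap := by
  refine ⟨?_, fun x => ?_⟩
  · simp [vectorState_apply]
  · change 0 ≤ vectorState e (star x * x)
    rw [vectorState_eq_inner, ContinuousLinearMap.star_eq_adjoint]
    change 0 ≤ inner ℂ _ (x.adjoint (x _))
    rw [ContinuousLinearMap.adjoint_inner_right, inner_self_eq_norm_sq_to_K]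
    norm_cast
    positivity

lemma vectorState_star (e : W) (x : EllTwo W →L[ℂ] EllTwo W) :
    vectorState e (star x) = star (vectorState e x) := by
  rw [vectorState_eq_inner, vectorState_eq_inner, ContinuousLinearMap.star_eq_adjoint,
    ContinuousLinearMap.adjoint_inner_right]
  exact (inner_conj_symm _ _).symm

end PartialPermutation

/-! ### Free copies of a matrix on the free product space -/

section FreeProduct

open Monoid.CoprodI

variable {ι K : Type} [DecidableEq ι] [DecidableEq K] [Monoid K]

/-- Alternating words; a basis of the free product of `ι` copies of `(ℓ²(K), 1)`. -/
abbrev AltWord (ι K : Type) [Monoid K] : Type := Word (fun _ : ι => K)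

/-- The (possibly trivial) component at `i` at the beginning of the word. -/
def headAt (i : ι) (w : AltWord ι K) : K := (Word.equivPair i w).head

/-- Replace the component at `i` at the beginning of the word. -/
def replaceAt (i : ι) (w : AltWord ι K) (k : K) : AltWord ι K :=
  (Word.equivPair i).symm { Word.equivPair i w with head := k }

@[simp] lemma headAt_replaceAt (i : ι) (w : AltWord ι K) (k : K) :
    headAt i (replaceAt i w k) = k := by simp [headAt, replaceAt]

@[simp] lemma replaceAt_replaceAt (i : ι) (w : AltWord ι K) (k l : K) :
    replaceAt i (replaceAt i w k) l = replaceAt i w l := by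
  simp [replaceAt]

@[simp] lemma replaceAt_headAt (i : ι) (w : AltWord ι K) :
    replaceAt i w (headAt i w) = w := by
  exact (Word.equivPair i).symm_apply_apply w

lemma headAt_of_fstIdx_ne {i : ι} {w : AltWord ι K} (h : w.fstIdx ≠ some i) :
    headAt i w = 1 := by
  rw [headAt, Word.equivPair_eq_of_fstIdx_ne h]

lemma fstIdx_replaceAt {i : ι} {w : AltWord ι K} (h : w.fstIdx ≠ some i) {k : K} (hk : k ≠ 1) :
    (replaceAt i w k).fstIdx = some i := by
  have : replaceAt i w k = Word.cons k w h hk := by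
    rw [replaceAt, Word.equivPair_symm, Word.rcons]
    simp [hk, Word.equivPair_eq_of_fstIdx_ne h]
  rw [this, Word.fstIdx_cons]

/-- The partial permutation replacing the component `j` at `i` by `k`. -/
def matrixUnitPerm (i : ι) (j k : K) : AltWord ι K ≃. AltWord ι K where
  toFun w := if headAt i w = j then some (replaceAt i w k) else none
  invFun w := if headAt i w = k then some (replaceAt i w j) else none
  inv v w := by
    constructor
    · intro h
      split_ifs at h with hw
      obtain rfl := Option.some_inj.1 h
      simp [← hw]
    · intro h
      split_ifs at h with hw
      obtain rfl := Option.some_inj.1 h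
      simp [← hw]

lemma basisVec_empty_replaceAt (i : ι) (k : K) :
    basisVec (Word.empty : AltWord ι K) (replaceAt i Word.empty k) = if k = 1 then 1 else 0 := by
  have h : (Word.empty : AltWord ι K).fstIdx ≠ some i := by simp [Word.fstIdx, Word.empty]
  by_cases hk : k = 1
  · subst hk
    rw [← headAt_of_fstIdx_ne h, replaceAt_headAt]
    simp
  · rw [if_neg hk, basisVec_of_ne]
    intro h'
    have := fstIdx_replaceAt h hk
    rw [h'] at this
    exact h this

variable [Fintype K]

/-- The action of a matrix on the `i`-th copy of `ℓ²(K)` in the free product. -/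
def amplify (i : ι) (T : Matrix K K ℂ) : EllTwo (AltWord ι K) →L[ℂ] EllTwo (AltWord ι K) :=
  ∑ j, ∑ k, T j k • partialPerm (matrixUnitPerm i j k)

lemma ellTwo_sum_apply {W α : Type} (s : Finset α) (f : α → EllTwo W) (w : W) :
    (∑ a ∈ s, f a) w = ∑ a ∈ s, f a w := by
  rw [lp.coeFn_sum, Finset.sum_apply]

/-- Splitting a word into its head at `i` and the rest makes the operator `T ⊗ 1`; multiplicativity
in `T` is read off this formula. -/
lemma amplify_apply (i : ι) (T : Matrix K K ℂ) (f : EllTwo (AltWord ι K)) (w : AltWord ι K) :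
    amplify i T f w = ∑ k, T (headAt i w) k * f (replaceAt i w k) := by
  simp only [amplify, sum_apply, ellTwo_sum_apply]
  rw [Finset.sum_eq_single (headAt i w)]
  · refine Finset.sum_congr rfl fun k _ => ?_
    change T _ _ * partialPerm _ f w = _
    rw [partialPerm_apply]
    change _ * Option.elim (if headAt i w = headAt i w then some (replaceAt i w k) else none) _ _ = _
    simp
  · intro j _ hj
    refine Finset.sum_eq_zero fun k _ => ?_
    change T _ _ * partialPerm _ f w = _
    rw [partialPerm_apply]
    change _ * Option.elim (if headAt i w = j then some (replaceAt i w k) else none) _ _ = _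
    simp [hj.symm]
  · simp

/-- `amplify i` as an algebra homomorphism. -/
def amplifyHom (i : ι) :
    Matrix K K ℂ →ₐ[ℂ] (EllTwo (AltWord ι K) →L[ℂ] EllTwo (AltWord ι K)) :=
  AlgHom.ofLinearMap
    { toFun := amplify i
      map_add' := fun S T => by simp [amplify, add_smul, Finset.sum_add_distrib]
      map_smul' := fun a T => by simp [amplify, mul_smul, Finset.smul_sum] }
    (by
      ext f w
      change amplify i 1 f w = f w
      simp [amplify_apply, Matrix.one_apply])
    (fun S T => by
      ext f w
      change amplify i (S * T) f w = amplify i S (amplify i T f) w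
      simp only [amplify_apply, headAt_replaceAt, replaceAt_replaceAt, Matrix.mul_apply,
        Finset.sum_mul, Finset.mul_sum]
      rw [Finset.sum_comm]
      simp only [mul_assoc])

lemma star_amplify (i : ι) (T : Matrix K K ℂ) : star (amplify i T) = amplify i T.conjTranspose := by
  simp only [amplify, star_sum, star_smul, star_partialPerm, Matrix.conjTranspose_apply]
  rw [Finset.sum_comm]
  rfl

lemma vectorState_amplify (i : ι) (T : Matrix K K ℂ) :
    vectorState (Word.empty : AltWord ι K) (amplify i T) = T 1 1 := by
  have h : (Word.empty : AltWord ι K).fstIdx ≠ some i := by simp [Word.fstIdx, Word.empty]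
  rw [vectorState_apply, amplify_apply, headAt_of_fstIdx_ne h]
  simp [basisVec_empty_replaceAt]

/-- A centered operator on the `i`-th copy maps vectors supported on words not starting with `i`
to vectors supported on words starting with `i`. -/
lemma amplify_apply_eq_zero {i : ι} {T : Matrix K K ℂ} (hT : T 1 1 = 0)
    {f : EllTwo (AltWord ι K)} (hf : ∀ w : AltWord ι K, w.fstIdx = some i → f w = 0)
    {w : AltWord ι K} (hw : w.fstIdx ≠ some i) : amplify i T f w = 0 := by
  rw [amplify_apply, headAt_of_fstIdx_ne hw]
  refine Finset.sum_eq_zero fun k _ => ?_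
  by_cases hk : k = 1
  · rw [hk, hT, zero_mul]
  · rw [hf _ (fstIdx_replaceAt hw hk), mul_zero]

/-- An alternating product of centered operators, applied to the vacuum, is supported on words whose
first index is that of the leftmost factor. Hence its vacuum coordinate vanishes. -/
lemma areFree_amplify (T : ι → Matrix K K ℂ) :
    AreFree (vectorState (Word.empty : AltWord ι K)).toLinearMap
      (fun i => Algebra.adjoin ℂ {amplify i (T i)}) := by
  have key : ∀ L : List (ι × (EllTwo (AltWord ι K) →L[ℂ] EllTwo (AltWord ι K))),
      (∀ p ∈ L, p.2 ∈ Algebra.adjoin ℂ {amplify p.1 (T p.1)} ∧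
        vectorState (Word.empty : AltWord ι K) p.2 = 0) →
      L.IsChain (fun p q => p.1 ≠ q.1) →
      ∀ w : AltWord ι K, w.fstIdx ≠ L.head?.map Prod.fst →
        (L.map Prod.snd).prod (basisVec Word.empty) w = 0 := by
    intro L
    induction L with
    | nil =>
      intro _ _ w hw
      simp only [List.map_nil, List.prod_nil, one_apply_eq_self]
      rw [basisVec_of_ne]
      rintro rfl
      simp [Word.fstIdx, Word.empty] at hw
    | cons p L ih =>
      intro hL hc w hw
      rw [List.isChain_cons] at hc
      obtain ⟨hp, h0⟩ := hL p (by simp)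
      -- The generated algebra lies in the image of the matrices, so centering becomes the vanishing
      -- of a matrix entry.
      have : p.2 ∈ (amplifyHom (K := K) p.1).range := by
        refine Algebra.adjoin_le ?_ hp
        rintro _ rfl
        exact ⟨T p.1, rfl⟩
      obtain ⟨S, hS⟩ := this
      have hS' : p.2 = amplify p.1 S := hS.symm
      rw [hS', vectorState_amplify] at h0
      simp only [List.map_cons, List.prod_cons, mul_apply_eq_comp, hS']
      refine amplify_apply_eq_zero h0 (fun v hv => ?_) (by simpa using hw)
      refine ih (fun q hq => hL q (by simp [hq])) hc.2 v ?_
      rw [hv]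
      intro h
      obtain ⟨q, hq, hq'⟩ := Option.map_eq_some_iff.1 h.symm
      exact hc.1 q hq hq'.symm
  intro L hne hL hc
  obtain ⟨p, L', rfl⟩ := List.exists_cons_of_ne_nil hne
  refine key _ hL hc Word.empty ?_
  simp [Word.fstIdx, Word.empty]

end FreeProduct

/-- A Hermitian matrix with prescribed discrete spectral measure at a basis vector. -/
lemma exists_isHermitian_pow_apply {K : Type} [Fintype K] [DecidableEq K] (e : K) (p d : K → ℝ)
    (hp : ∀ j, 0 ≤ p j) (hsum : ∑ j, p j = 1) :
    ∃ T : Matrix K K ℂ, T.IsHermitian ∧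
      ∀ n : ℕ, (T ^ n) e e = ((∑ j, p j * d j ^ n : ℝ) : ℂ) := by
  -- The unit vector `ξ` becomes column `e` of a unitary `U`; then `U⋆ D U` with `D = diag d` has
  -- the weights `|ξ_j|² = p_j` at the entry `(e, e)`.
  let ξ : EuclideanSpace ℂ K := WithLp.toLp 2 fun j => ((√(p j) : ℝ) : ℂ)
  have hξ : ‖ξ‖ = 1 := by
    rw [EuclideanSpace.norm_eq, Real.sqrt_eq_one]
    simp only [ξ, Complex.norm_real, Real.norm_eq_abs, sq_abs, Real.sq_sqrt (hp _), hsum]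
  obtain ⟨b, hb⟩ := Orthonormal.exists_orthonormalBasis_extension_of_card_eq (𝕜 := ℂ)
    (E := EuclideanSpace ℂ K) (ι := K) (by simp) (v := fun _ => ξ) (s := {e})
    (by
      rw [orthonormal_iff_ite]
      rintro ⟨i, rfl⟩ ⟨j, rfl⟩
      simp [Set.domRestrict, hξ])
  have hbe : b e = ξ := hb e rfl
  let U : Matrix K K ℂ := Matrix.of fun j k => b k j
  have hU : U.conjTranspose * U = 1 := by
    ext j k
    have := orthonormal_iff_ite.1 b.orthonormal j k
    rw [EuclideanSpace.inner_eq_star_dotProduct] at this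
    rw [Matrix.one_apply, ← this, Matrix.mul_apply, dotProduct]
    refine Finset.sum_congr rfl fun l _ => ?_
    simp [U, mul_comm]
  have hU' : U * U.conjTranspose = 1 := mul_eq_one_comm.1 hU
  let D : Matrix K K ℂ := Matrix.diagonal fun j => (d j : ℂ)
  have hD : D.conjTranspose = D := by
    rw [Matrix.diagonal_conjTranspose]
    congr 1
    ext j
    simp
  refine ⟨U.conjTranspose * D * U, ?_, fun n => ?_⟩
  · simp [Matrix.IsHermitian, Matrix.conjTranspose_mul, hD, Matrix.mul_assoc]
  · have hpow : (U.conjTranspose * D * U) ^ n = U.conjTranspose * D ^ n * U := by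
      induction n with
      | zero => simp [hU]
      | succ n ih =>
        rw [pow_succ, ih, pow_succ]
        calc U.conjTranspose * D ^ n * U * (U.conjTranspose * D * U)
            = U.conjTranspose * D ^ n * (U * U.conjTranspose) * D * U := by
              simp only [Matrix.mul_assoc]
          _ = _ := by rw [hU']; simp only [Matrix.mul_assoc, Matrix.mul_one]
    rw [hpow, Matrix.diagonal_pow, Matrix.mul_apply]
    push_cast
    refine Finset.sum_congr rfl fun j _ => ?_
    rw [Matrix.mul_diagonal]
    have : ((√(p j) : ℝ) : ℂ) * ((√(p j) : ℝ) : ℂ) = p j := by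
      rw [← Complex.ofReal_mul, Real.mul_self_sqrt (hp j)]
    simp only [Matrix.conjTranspose_apply, U, Matrix.of_apply, hbe, ξ, Pi.pow_apply]
    rw [← this]
    simp
    ring

/-! ### Existence of laws and of free convolution powers -/

section Law

variable {A : Type} [CStarAlgebra A] {φ : A →ₗ[ℂ] ℂ}

/-- By polarization `4x = (x + 1)² - (x - 1)²`, and a state is real on each square. -/
lemma IsState.im_apply_eq_zero (hφ : IsState φ) {x : A} (hx : IsSelfAdjoint x) :
    (φ x).im = 0 := by
  have h1 := (Complex.nonneg_iff.1 (hφ.2 (x + 1))).2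
  have h2 := (Complex.nonneg_iff.1 (hφ.2 (x - 1))).2
  have h : star (x + 1) * (x + 1) - star (x - 1) * (x - 1) = (4 : ℂ) • x := by
    rw [star_add, star_sub, hx.star_eq, star_one, Algebra.smul_def, map_ofNat]
    noncomm_ring
  have h3 := congrArg (fun y => (φ y).im) h
  simp only [map_sub, map_smul, Complex.sub_im, ← h1, ← h2] at h3
  simpa using h3.symm

/-- Riesz–Markov on the spectrum, applied to `f ↦ φ (f(a))`. Monotonicity holds because `g - f` is
the square of `√(g - f)`. -/
lemma IsState.exists_isLawOf (hφ : IsState φ) {a : A} (ha : IsSelfAdjoint a) :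
    ∃ μ : Measure ℝ, IsLawOf φ a μ := by
  let X := spectrum ℝ a
  have : CompactSpace X := isCompact_iff_compactSpace.1 (spectrum.isCompact a)
  let Ψ : C(X, ℝ) →⋆ₐ[ℝ] A := cfcHom ha
  have hmono : ∀ f g : C(X, ℝ), f ≤ g → (φ (Ψ f)).re ≤ (φ (Ψ g)).re := by
    intro f g hfg
    let h : C(X, ℝ) := ⟨fun x => √(g x - f x), by fun_prop⟩
    have hh : g = f + star h * h := by
      ext x
      have : 0 ≤ g x - f x := sub_nonneg.2 (hfg x)
      simp [h, Real.mul_self_sqrt this]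
    have := (Complex.nonneg_iff.1 (hφ.2 (Ψ h))).1
    rw [hh, map_add, map_add, map_mul, map_star, Complex.add_re]
    linarith
  let Λ : CompactlySupportedContinuousMap X ℝ →ₚ[ℝ] ℝ :=
    { toFun := fun f => (φ (Ψ f.toContinuousMap)).re
      map_add' := fun f g => by
        have : (f + g).toContinuousMap = f.toContinuousMap + g.toContinuousMap := rfl
        rw [this, map_add, map_add, Complex.add_re]
      map_smul' := fun c f => by
        have : (c • f).toContinuousMap = c • f.toContinuousMap := rfl
        have h2 : c • Ψ f.toContinuousMap = (c : ℂ) • Ψ f.toContinuousMap := by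
          rw [← Complex.coe_smul]
        rw [this, map_smul, h2, map_smul]
        simp
      monotone' := fun f g hfg => hmono _ _ hfg }
  let ν : Measure X := RealRMK.rieszMeasure Λ
  have : IsFiniteMeasure ν := by infer_instance
  have hint : ∀ f : C(X, ℝ), ∫ x, f x ∂ν = (φ (Ψ f)).re := fun f =>
    RealRMK.integral_rieszMeasure Λ ⟨f, HasCompactSupport.of_compactSpace _⟩
  have hme : MeasurableEmbedding (Subtype.val : X → ℝ) :=
    MeasurableEmbedding.subtype_coe (spectrum.isClosed a).measurableSet
  refine ⟨ν.map Subtype.val, ?_, ⟨X, spectrum.isCompact a, ?_⟩, fun k => ?_⟩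
  · have h1 := hint 1
    rw [map_one, hφ.1] at h1
    simp only [ContinuousMap.one_apply, integral_const, smul_eq_mul, mul_one, Complex.one_re] at h1
    have : IsProbabilityMeasure ν := ⟨by
      rw [← ENNReal.toReal_eq_one_iff]
      exact h1⟩
    exact Measure.isProbabilityMeasure_map hme.measurable.aemeasurable
  · rw [hme.map_apply]
    simp [X]
  · rw [hme.integral_map]
    have hk : Ψ ((ContinuousMap.restrict X (.id ℝ)) ^ k) = a ^ k := by
      rw [map_pow]
      congr 1
      exact cfcHom_id ha
    have := hint ((ContinuousMap.restrict X (.id ℝ)) ^ k)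
    rw [hk] at this
    have h2 : ∫ x : X, (x : ℝ) ^ k ∂ν = (φ (a ^ k)).re := by
      rw [← this]
      rfl
    rw [h2]
    exact Complex.ext rfl (hφ.im_apply_eq_zero (ha.pow k))

end Law

/-- Free convolution powers of finitely supported probability measures exist. -/
lemma exists_isFreeConvPow {s : ℕ} (p d : Fin (s + 1) → ℝ) (hp : ∀ j, 0 ≤ p j)
    (hsum : ∑ j, p j = 1) (n : ℕ) :
    ∃ τ : Measure ℝ, IsFreeConvPow (∑ j, ENNReal.ofReal (p j) • Measure.dirac (d j)) n τ := by
  -- The monoid structure only serves to distinguish an index, the unit, for the vacuum.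
  let K := Multiplicative (Fin (s + 1))
  obtain ⟨T, hT, hTk⟩ := exists_isHermitian_pow_apply (K := K) 1
    (fun j => p j.toAdd) (fun j => d j.toAdd) (fun j => hp _)
    ((Multiplicative.toAdd.sum_comp p).trans hsum)
  have hst := isState_vectorState (Monoid.CoprodI.Word.empty : AltWord (Fin n) K)
  have hsa : ∀ i : Fin n, IsSelfAdjoint (amplify i T) := fun i => by
    rw [IsSelfAdjoint, star_amplify, hT.eq]
  obtain ⟨τ, hτ⟩ := hst.exists_isLawOf (a := ∑ i : Fin n, amplify i T)
    (by rw [IsSelfAdjoint, star_sum]; exact Finset.sum_congr rfl fun i _ => (hsa i).star_eq)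
  refine ⟨τ, EllTwo (AltWord (Fin n) K) →L[ℂ] EllTwo (AltWord (Fin n) K), inferInstance, _,
    fun i => amplify i T, hst, hsa, areFree_amplify _, fun i => ⟨?_, ?_, fun k => ?_⟩, hτ⟩
  · constructor
    simp only [Measure.coe_finsetSum, Finset.sum_apply, Measure.smul_apply, measure_univ,
      smul_eq_mul, mul_one]
    rw [← ENNReal.ofReal_sum_of_nonneg fun j _ => hp j, hsum, ENNReal.ofReal_one]
  · refine ⟨Set.range d, (Set.finite_range d).isCompact, ?_⟩
    simp [Measure.dirac_apply]
  · change vectorState _ (amplify i T ^ k) = _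
    have : amplify i T ^ k = amplify i (T ^ k) := (map_pow (amplifyHom i) T k).symm
    rw [this, vectorState_amplify, hTk,
      Multiplicative.toAdd.sum_comp fun j => p j * d j ^ k, integral_finsetSum_measure]
    · congr 1
      refine Finset.sum_congr rfl fun j _ => ?_
      rw [integral_smul_measure, integral_dirac, ENNReal.toReal_ofReal (hp j), smul_eq_mul]
    · intro j _
      exact (integrable_dirac (by simp)).smul_measure ENNReal.ofReal_ne_top

/-! ### Formal resolvents of sums of free variables -/

section FormalResolvent

open PowerSeries

variable {A : Type} [Ring A] [Algebra ℂ A]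

/-- Scalar formal power series as power series with coefficients in `A`. -/
def scalarSeries (A : Type) [Ring A] [Algebra ℂ A] : ℂ⟦X⟧ →+* A⟦X⟧ :=
  PowerSeries.map (algebraMap ℂ A)

lemma scalarSeries_commute (f : ℂ⟦X⟧) (g : A⟦X⟧) : Commute (scalarSeries A f) g := by
  ext n
  rw [coeff_mul, coeff_mul, ← Finset.Nat.sum_antidiagonal_swap]
  refine Finset.sum_congr rfl fun p _ => ?_
  simp [scalarSeries, Algebra.commutes]

lemma coeff_scalarSeries_mul_C (f : ℂ⟦X⟧) (b : A) (n : ℕ) :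
    coeff n (scalarSeries A f * C b) = coeff n f • b := by
  rw [coeff_mul_C, Algebra.smul_def, scalarSeries, coeff_map]

lemma constantCoeff_scalarSeries (f : ℂ⟦X⟧) :
    constantCoeff (scalarSeries A f) = algebraMap ℂ A (constantCoeff f) := by
  rw [← coeff_zero_eq_constantCoeff_apply, ← coeff_zero_eq_constantCoeff_apply, scalarSeries,
    coeff_map]

lemma scalarSeries_X : scalarSeries A X = X := by
  ext n
  simp [scalarSeries, coeff_X]

/-- The coefficients of the inverse of `E - τ S` for formal power series `E`, `τ`. -/
lemma coeff_formalResolvent {E τ : ℂ⟦X⟧} (hE : constantCoeff E = 1) (hτ : X ∣ τ) {S : A}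
    {Y : A⟦X⟧} (hY : Y * (scalarSeries A E - scalarSeries A τ * C S) = 1) (N : ℕ) :
    coeff N Y = ∑ k ∈ Finset.range (N + 1), coeff N (τ ^ k * E⁻¹ ^ (k + 1)) • S ^ k := by
  set Q := scalarSeries A E - scalarSeries A τ * C S with hQ
  have hEE : E * E⁻¹ = 1 := PowerSeries.mul_inv_cancel E (by simp [hE])
  have hgeom : ∀ m : ℕ, Q * ∑ k ∈ Finset.range m, scalarSeries A (τ ^ k * E⁻¹ ^ (k + 1)) * C (S ^ k)
      = 1 - scalarSeries A (τ ^ m * E⁻¹ ^ m) * C (S ^ m) := by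
    intro m
    induction m with
    | zero => simp
    | succ m ih =>
      rw [Finset.sum_range_succ, mul_add, ih, hQ, sub_mul]
      have h1 : scalarSeries A E * (scalarSeries A (τ ^ m * E⁻¹ ^ (m + 1)) * C (S ^ m)) =
          scalarSeries A (τ ^ m * E⁻¹ ^ m) * C (S ^ m) := by
        rw [← mul_assoc, ← map_mul]
        congr 2
        calc E * (τ ^ m * E⁻¹ ^ (m + 1)) = τ ^ m * E⁻¹ ^ m * (E * E⁻¹) := by ring
          _ = _ := by rw [hEE, mul_one]
      have h2 : scalarSeries A τ * C S * (scalarSeries A (τ ^ m * E⁻¹ ^ (m + 1)) * C (S ^ m)) =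
          scalarSeries A (τ ^ (m + 1) * E⁻¹ ^ (m + 1)) * C (S ^ (m + 1)) := by
        rw [mul_assoc, ← mul_assoc (C S), ← (scalarSeries_commute _ (C S)).eq, mul_assoc,
          ← map_mul, ← mul_assoc, ← map_mul, ← pow_succ', ← mul_assoc, ← pow_succ']
      rw [h1, h2]
      abel
  -- As `X ∣ τ`, the remainder of the geometric sum is divisible by `X ^ (N + 1)`.
  have hrem : coeff N (Y * (scalarSeries A (τ ^ (N + 1) * E⁻¹ ^ (N + 1)) * C (S ^ (N + 1)))) = 0 := by
    obtain ⟨σ, rfl⟩ := hτ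
    have : Y * (scalarSeries A ((X * σ) ^ (N + 1) * E⁻¹ ^ (N + 1)) * C (S ^ (N + 1))) =
        X ^ (N + 1) * (Y * (scalarSeries A (σ ^ (N + 1) * E⁻¹ ^ (N + 1)) * C (S ^ (N + 1)))) := by
      rw [mul_pow, mul_assoc (X ^ (N + 1)), map_mul, map_pow, scalarSeries_X, ← mul_assoc Y,
        ← mul_assoc Y, ← (X_pow_mul (n := N + 1) (φ := Y)), mul_assoc, mul_assoc]
    rw [this, coeff_X_pow_mul', if_neg (by omega)]
  have hg := hgeom (N + 1)
  have : Y = ∑ k ∈ Finset.range (N + 1), scalarSeries A (τ ^ k * E⁻¹ ^ (k + 1)) * C (S ^ k) +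
      Y * (scalarSeries A (τ ^ (N + 1) * E⁻¹ ^ (N + 1)) * C (S ^ (N + 1))) := by
    have h3 := congrArg (Y * ·) hg
    simp only [← mul_assoc, hY, one_mul, mul_sub, mul_one] at h3
    rw [h3]
    simp only [mul_assoc]
    abel
  rw [this, map_add, hrem, add_zero, map_sum]
  exact Finset.sum_congr rfl fun k _ => coeff_scalarSeries_mul_C _ _ _

lemma exists_formalResolvent {E τ : ℂ⟦X⟧} (hE : constantCoeff E = 1) (hτ : X ∣ τ) (S : A) :
    ∃ Y : A⟦X⟧, Y * (scalarSeries A E - scalarSeries A τ * C S) = 1 ∧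
      (scalarSeries A E - scalarSeries A τ * C S) * Y = 1 := by
  have h : constantCoeff (scalarSeries A E - scalarSeries A τ * C S) = ((1 : Aˣ) : A) := by
    have h0 : constantCoeff τ = 0 := X_dvd_iff.1 hτ
    simp [constantCoeff_scalarSeries, hE, h0]
  exact ⟨_, invOfUnit_mul _ _ h, mul_invOfUnit _ _ h⟩

end FormalResolvent

/-! ### Freeness and the expectation of the resolvent -/

section FreeSum

open PowerSeries

variable {A : Type} [CStarAlgebra A] {φ : A →ₗ[ℂ] ℂ} {ι : Type} [Fintype ι] [DecidableEq ι]
  {a : ι → A}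

/-- Unfolding `hZ` repeatedly expands `Z j` into alternating products of centered coefficients; `L`
collects the factors already split off. The induction descends because `u j` has no constant term.
-/
lemma AreFree.apply_prod_mul_coeff_eq_zero
    (hfree : AreFree φ (fun i => Algebra.adjoin ℂ {a i})) {u Z : ι → A⟦X⟧}
    (hu : ∀ i p, coeff p (u i) ∈ Algebra.adjoin ℂ {a i} ∧ φ (coeff p (u i)) = 0)
    (hu0 : ∀ i, coeff 0 (u i) = 0)
    (hZ : ∀ i, Z i = u i * (1 + ∑ j ∈ Finset.univ.erase i, Z j)) (N : ℕ) :
    ∀ (L : List (ι × A)) (j : ι), (∀ p ∈ L, p.2 ∈ Algebra.adjoin ℂ {a p.1} ∧ φ p.2 = 0) →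
      L.IsChain (fun p q => p.1 ≠ q.1) → (∀ p ∈ L.getLast?, p.1 ≠ j) →
      φ ((L.map Prod.snd).prod * coeff N (Z j)) = 0 := by
  induction N using Nat.strong_induction_on with
  | _ N ih =>
  intro L j hL hc hlast
  have hmem : ∀ r, ∀ p ∈ L ++ [(j, coeff r (u j))],
      p.2 ∈ Algebra.adjoin ℂ {a p.1} ∧ φ p.2 = 0 := by
    intro r p hp
    rcases List.mem_append.1 hp with hp | hp
    · exact hL p hp
    · rw [List.mem_singleton] at hp
      subst hp
      exact hu j r
  have hchain : ∀ r, (L ++ [(j, coeff r (u j))]).IsChain (fun p q => p.1 ≠ q.1) := by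
    intro r
    rw [List.isChain_append]
    refine ⟨hc, List.isChain_singleton _, fun p hp q hq => ?_⟩
    simp only [List.head?_cons, Option.mem_def, Option.some.injEq] at hq
    subst hq
    exact hlast p hp
  rw [hZ j, mul_add, mul_one, map_add, mul_add, map_add, Finset.mul_sum, map_sum, Finset.mul_sum,
    map_sum]
  have h1 : φ ((L.map Prod.snd).prod * coeff N (u j)) = 0 := by
    have := hfree (L ++ [(j, coeff N (u j))]) (by simp) (hmem N) (hchain N)
    simpa using this
  rw [h1, zero_add]
  refine Finset.sum_eq_zero fun k hk => ?_
  rw [coeff_mul, Finset.mul_sum, map_sum]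
  refine Finset.sum_eq_zero fun pq hpq => ?_
  rw [Finset.HasAntidiagonal.mem_antidiagonal] at hpq
  by_cases h0 : pq.1 = 0
  · rw [h0, hu0]
    simp
  · have := ih pq.2 (by omega) (L ++ [(j, coeff pq.1 (u j))]) k (hmem _) (hchain _) (by
      intro p hp
      simp only [List.getLast?_append, List.getLast?_singleton, Option.some_or, Option.mem_def,
        Option.some.injEq] at hp
      subst hp
      exact (Finset.ne_of_mem_erase hk).symm)
    simpa [mul_assoc] using this

/-- With `w i` and its resolvent `v i = (1 - w i)⁻¹`, the operator to invert is `1 - ∑ w i`. Thus `Y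
= 1 + ∑ Z i` with `Z i = w i * Y`, and `Z i = (v i - 1)(1 + ∑_{j ≠ i} Z j)`. The factor `M⁻¹` in `v
i` is what makes `v i - 1` centered. -/
lemma AreFree.apply_coeff_formalResolvent (hφ : φ 1 = 1)
    (hfree : AreFree φ (fun i => Algebra.adjoin ℂ {a i})) {M : ℂ⟦X⟧}
    (hM : ∀ i k, φ (a i ^ k) = coeff k M) (hM0 : constantCoeff M = 1) {Y : A⟦X⟧}
    (hY : (scalarSeries A (1 + (Fintype.card ι : ℂ⟦X⟧) * (M - 1)) -
      scalarSeries A (X * M) * C (∑ i, a i)) * Y = 1) (N : ℕ) :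
    φ (coeff N Y) = if N = 0 then 1 else 0 := by
  have hMM : M * M⁻¹ = 1 := PowerSeries.mul_inv_cancel M (by simp [hM0])
  let G : ι → A⟦X⟧ := fun i => PowerSeries.mk fun k => a i ^ k
  have hG : ∀ i, G i * (1 - X * C (a i)) = 1 := by
    intro i
    ext n
    rw [mul_sub, mul_one, map_sub, ← mul_assoc, coeff_mul_C]
    cases n with
    | zero => simp [G]
    | succ n => simp [G, coeff_succ_mul_X, pow_succ, coeff_one]
  let v : ι → A⟦X⟧ := fun i => scalarSeries A M⁻¹ * G i
  let w : ι → A⟦X⟧ := fun i => 1 - scalarSeries A M * (1 - X * C (a i))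
  let u : ι → A⟦X⟧ := fun i => v i - 1
  let Z : ι → A⟦X⟧ := fun i => w i * Y
  have hvw : ∀ i, v i * (1 - w i) = 1 := by
    intro i
    simp only [v, w, sub_sub_cancel]
    calc scalarSeries A M⁻¹ * G i * (scalarSeries A M * (1 - X * C (a i)))
        = scalarSeries A (M * M⁻¹) * (G i * (1 - X * C (a i))) := by
          rw [← mul_assoc, mul_assoc _ (G i), ← (scalarSeries_commute M (G i)).eq, ← mul_assoc,
            ← map_mul, mul_comm M⁻¹, mul_assoc]
      _ = 1 := by rw [hMM, hG, map_one, one_mul]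
  have hsum : (1 - ∑ i, w i) * Y = 1 := by
    refine Eq.trans ?_ hY
    congr 1
    simp only [w, Finset.sum_sub_distrib, Finset.sum_const, Finset.card_univ, ← Finset.mul_sum,
      map_add, map_mul, map_sub, map_one, map_natCast, map_sum, scalarSeries_X, nsmul_eq_mul,
      mul_sub, mul_one]
    rw [X_mul (φ := scalarSeries A M), mul_assoc (scalarSeries A M)]
    have : (Fintype.card ι : A⟦X⟧) * scalarSeries A M =
        ∑ i : ι, scalarSeries A M := by simp
    rw [this]
    simp only [Finset.sum_const, Finset.card_univ, nsmul_eq_mul]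
    abel
  have hYZ : Y = 1 + ∑ i, Z i := by
    rw [sub_mul, one_mul, Finset.sum_mul, sub_eq_iff_eq_add] at hsum
    exact hsum
  have hZ : ∀ i, Z i = u i * (1 + ∑ j ∈ Finset.univ.erase i, Z j) := by
    intro i
    have h1 : 1 + ∑ j ∈ Finset.univ.erase i, Z j = Y - Z i := by
      rw [hYZ, ← Finset.add_sum_erase _ _ (Finset.mem_univ i)]
      abel
    have h2 : v i * (Y - Z i) = Y := by
      have : Y - Z i = (1 - w i) * Y := by simp only [Z, sub_mul, one_mul]
      rw [this, ← mul_assoc, hvw, one_mul]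
    rw [h1, sub_mul, h2, one_mul, sub_sub_cancel]
  have hcv : ∀ i p, coeff p (v i) =
      ∑ x ∈ Finset.HasAntidiagonal.antidiagonal p, coeff x.1 M⁻¹ • a i ^ x.2 := by
    intro i p
    rw [coeff_mul]
    refine Finset.sum_congr rfl fun x _ => ?_
    rw [Algebra.smul_def]
    simp [scalarSeries, G]
  have hu : ∀ i p, coeff p (u i) ∈ Algebra.adjoin ℂ {a i} ∧ φ (coeff p (u i)) = 0 := by
    intro i p
    have h1 : coeff p (1 : A⟦X⟧) = if p = 0 then 1 else 0 := coeff_one p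
    constructor
    · simp only [u, map_sub, hcv, h1]
      refine sub_mem (sum_mem fun x _ => ?_) ?_
      · exact Subalgebra.smul_mem _ (pow_mem (Algebra.self_mem_adjoin_singleton ℂ (a i)) _) _
      · split_ifs
        · exact one_mem _
        · exact zero_mem _
    · have h2 : φ (coeff p (v i)) = coeff p (M⁻¹ * M) := by
        rw [hcv, coeff_mul, map_sum]
        exact Finset.sum_congr rfl fun x _ => by rw [map_smul, hM, smul_eq_mul]
      simp only [u, map_sub, h2, h1]
      rw [mul_comm, hMM, coeff_one]
      split_ifs <;> simp [hφ]
  have hu0 : ∀ i, coeff 0 (u i) = 0 := by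
    intro i
    simp [u, v, G, constantCoeff_scalarSeries, hM0]
  have key := hfree.apply_prod_mul_coeff_eq_zero hu hu0 hZ N []
  simp only [List.map_nil, List.prod_nil, one_mul] at key
  rw [hYZ, map_add, map_sum, map_add, map_sum, Finset.sum_eq_zero, add_zero, coeff_one]
  · split_ifs <;> simp [hφ]
  · intro i _
    exact key i (by simp) List.isChain_nil (by simp)

end FreeSum

/-- The series of moments of a measure. -/
def momentSeries (μ : Measure ℝ) : PowerSeries ℂ :=
  PowerSeries.mk fun k => ((∫ x, x ^ k ∂μ : ℝ) : ℂ)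

/-- The relation between the moments of a free convolution power and those of the measure, obtained
by expanding the resolvent `(1 + n (M - 1) - X M S)⁻¹`. -/
lemma IsFreeConvPow.sum_coeff_mul_moment {μ τ : Measure ℝ} {n : ℕ} (h : IsFreeConvPow μ n τ)
    (hμ : IsProbabilityMeasure μ) (N : ℕ) :
    ∑ k ∈ Finset.range (N + 1), PowerSeries.coeff N ((PowerSeries.X * momentSeries μ) ^ k *
      (1 + (n : PowerSeries ℂ) * (momentSeries μ - 1))⁻¹ ^ (k + 1)) *
        ((∫ x, x ^ k ∂τ : ℝ) : ℂ) = if N = 0 then 1 else 0 := by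
  obtain ⟨A, _, φ, a, hφ, -, hfree, hlaw, hS⟩ := h
  have hM0 : PowerSeries.constantCoeff (momentSeries μ) = 1 := by
    rw [← PowerSeries.coeff_zero_eq_constantCoeff_apply, momentSeries, PowerSeries.coeff_mk]
    simp
  have hE : PowerSeries.constantCoeff (1 + (n : PowerSeries ℂ) * (momentSeries μ - 1)) = 1 := by
    simp [hM0]
  obtain ⟨Y, hY1, hY2⟩ := exists_formalResolvent (A := A) hE (dvd_mul_right PowerSeries.X _)
    (∑ i, a i)
  have := hfree.apply_coeff_formalResolvent hφ.1 (M := momentSeries μ)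
    (fun i k => by rw [(hlaw i).2.2 k, momentSeries, PowerSeries.coeff_mk]) hM0 (Y := Y)
    (by rw [Fintype.card_fin]; exact hY2) N
  rw [← this, coeff_formalResolvent hE (dvd_mul_right _ _) hY1, map_sum]
  refine Finset.sum_congr rfl fun k _ => ?_
  rw [map_smul, smul_eq_mul, hS.2.2 k]

/-! ### The compound free Poisson variable on the full Fock space -/

section AbstractResolvent

variable {K B ι : Type} [CommRing K] [Ring B] [Algebra K B] [Fintype ι] [DecidableEq ι]

/-- Expectation of the resolvent of `∑ i, z i (l i + r i) (l i + r i)⋆` for free creation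
operators `l i`. -/
lemma apply_fockResolvent {Φ : B →ₗ[K] K} (hΦ : Φ 1 = 1) {l l' : ι → B}
    (hl : ∀ i j, l' i * l j = if i = j then 1 else 0) (hΦl : ∀ i x, Φ (l i * x) = 0)
    (hΦl' : ∀ i x, Φ (x * l' i) = 0) {t e : K} {z r α : ι → K}
    (hα : ∀ i, α i = t * (z i * (α i + r i))) (he : e = 1 + ∑ i, α i * r i) {W Y : B}
    (hW : (1 - ∑ i, α i • l i) * W = 1)
    (hY : Y * (e • (1 : B) - t • ∑ i, z i • ((l i + r i • (1 : B)) * (l' i + r i • (1 : B)))) = 1) :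
    Φ Y = 1 := by
  have hW' : W = 1 + ∑ i, α i • (l i * W) := by
    rw [sub_mul, one_mul, Finset.sum_mul, sub_eq_iff_eq_add] at hW
    simpa only [smul_mul_assoc] using hW
  -- Each annihilator acts on `W` as the scalar `α i`, up to a term ending in `l' i`, which `Φ` will
  -- kill.
  have hlW : ∀ i, l' i * W = l' i + α i • W := by
    intro i
    conv_lhs => rw [hW']
    rw [mul_add, mul_one, Finset.mul_sum, Finset.sum_eq_single i]
    · rw [mul_smul_comm, ← mul_assoc, hl, if_pos rfl, one_mul]
    · intro j _ hj
      rw [mul_smul_comm, ← mul_assoc, hl, if_neg hj.symm, zero_mul, smul_zero]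
    · simp
  have hΦW : Φ W = 1 := by
    rw [hW', map_add, map_sum, hΦ, Finset.sum_eq_zero, add_zero]
    intro i _
    rw [map_smul, hΦl, smul_zero]
  have hterm : ∀ i, t • (z i • ((l i + r i • (1 : B)) * (l' i + r i • (1 : B)))) * W =
      t • (z i • ((l i + r i • (1 : B)) * l' i)) + α i • (l i * W) + (α i * r i) • W := by
    intro i
    have h1 : (l' i + r i • (1 : B)) * W = l' i + (α i + r i) • W := by
      rw [add_mul, hlW, smul_mul_assoc, one_mul, add_smul, add_assoc]
    have h2 : t * (z i * (α i + r i)) = α i := (hα i).symm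
    rw [smul_mul_assoc, smul_mul_assoc, mul_assoc, h1, mul_add, smul_add, smul_add,
      mul_smul_comm, smul_smul (z i), smul_smul t (z i * _), h2, add_mul (l i) _ W, smul_add (α i),
      smul_mul_assoc (r i), one_mul, smul_smul (α i), add_assoc]
  -- The equations for `α` and `e` are chosen so that all terms in `W` cancel here, leaving `1` and
  -- terms ending in some `l' i`.
  have hres : (e • (1 : B) - t • ∑ i, z i • ((l i + r i • (1 : B)) * (l' i + r i • (1 : B)))) * W =
      1 - ∑ i, t • (z i • ((l i + r i • (1 : B)) * l' i)) := by
    rw [sub_mul, Finset.smul_sum, Finset.sum_mul, Finset.sum_congr rfl fun i _ => hterm i,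
      Finset.sum_add_distrib, Finset.sum_add_distrib, smul_mul_assoc, one_mul, he, add_smul,
      one_smul, Finset.sum_smul]
    nth_rewrite 1 [hW']
    abel
  have hYW : Y = W + ∑ i, t • (z i • (Y * (l i + r i • (1 : B)) * l' i)) := by
    have := congrArg (Y * ·) hres
    simp only [← mul_assoc, hY, one_mul, mul_sub, mul_one, Finset.mul_sum, mul_smul_comm] at this
    rw [this]
    abel
  rw [hYW, map_add, hΦW, map_sum, Finset.sum_eq_zero, add_zero]
  intro i _
  rw [map_smul, map_smul, hΦl', smul_zero, smul_zero]

end AbstractResolvent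

/-! ### Creation operators on the full Fock space -/

section Fock

variable {s : ℕ}

/-- The partial permutation removing the first letter `i` from a word. -/
def tailPerm (i : Fin s) : List (Fin s) ≃. List (Fin s) where
  toFun w := if w.head? = some i then some w.tail else none
  invFun w := some (i :: w)
  inv v w := by
    cases v with
    | nil => simp
    | cons j v =>
      by_cases h : j = i
      · subst h
        simp [eq_comm]
      · simp [h, Ne.symm h]

/-- The bounded operators on the full Fock space of `ℂ ^ s`. -/
abbrev FockOp (s : ℕ) : Type := EllTwo (List (Fin s)) →L[ℂ] EllTwo (List (Fin s))

/-- The free creation operators on the full Fock space of `ℂ ^ s`. -/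
def creation (i : Fin s) : FockOp s :=
  partialPerm (tailPerm i)

lemma star_creation_mul (i j : Fin s) :
    star (creation i) * creation j = if i = j then 1 else 0 := by
  rw [creation, star_partialPerm]
  ext f w
  change creation j f (i :: w) = _
  rw [creation, partialPerm_apply]
  by_cases h : i = j
  · subst h
    change Option.elim (if (i :: w).head? = some i then some (i :: w).tail else none) _ _ = _
    simp
  · change Option.elim (if (i :: w).head? = some j then some (i :: w).tail else none) _ _ = _
    simp [h]

lemma vectorState_creation_mul (i : Fin s) (x : FockOp s) :
    vectorState [] (creation i * x) = 0 := rfl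

lemma vectorState_mul_star_creation (i : Fin s) (x : FockOp s) :
    vectorState [] (x * star (creation i)) = 0 := by
  have h := vectorState_star [] (creation i * star x)
  rw [vectorState_creation_mul, star_mul, star_star, star_zero] at h
  exact h

/-- The variable `∑ i, z i (l i + √(c i)) (l i + √(c i))⋆`. -/
def fockPoisson (c z : Fin s → ℝ) : FockOp s :=
  ∑ i, (z i : ℂ) • ((creation i + ((√(c i) : ℝ) : ℂ) • 1) *
    (star (creation i) + ((√(c i) : ℝ) : ℂ) • 1))

lemma isSelfAdjoint_fockPoisson (c z : Fin s → ℝ) : IsSelfAdjoint (fockPoisson c z) := by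
  rw [IsSelfAdjoint, fockPoisson, star_sum]
  refine Finset.sum_congr rfl fun i _ => ?_
  simp [star_smul, star_mul]

/-- The series `∑ k ≥ 1, ρ_k X ^ k` of moments of `∑ i, c i δ_{z i}`. -/
def weightSeries (c z : Fin s → ℝ) : PowerSeries ℂ :=
  PowerSeries.mk fun k => if k = 0 then 0 else ∑ i, (c i : ℂ) * (z i : ℂ) ^ k

open PowerSeries in
/-- The expectation of coefficients, as a linear map over formal power series. -/
def coeffwise {A : Type} [Ring A] [Algebra ℂ A] (φ : A →ₗ[ℂ] ℂ) :
    letI : Algebra ℂ⟦X⟧ A⟦X⟧ := (scalarSeries A).toAlgebra' fun f g => (scalarSeries_commute f g).eq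
    A⟦X⟧ →ₗ[ℂ⟦X⟧] ℂ⟦X⟧ :=
  letI : Algebra ℂ⟦X⟧ A⟦X⟧ := (scalarSeries A).toAlgebra' fun f g => (scalarSeries_commute f g).eq
  { toFun := fun g => PowerSeries.mk fun n => φ (coeff n g)
    map_add' := fun g h => by ext; simp
    map_smul' := fun f g => by
      ext n
      change coeff n (PowerSeries.mk fun n => φ (coeff n (scalarSeries A f * g))) = coeff n (f * _)
      simp only [coeff_mk, coeff_mul, map_sum, scalarSeries, coeff_map, ← Algebra.smul_def,
        map_smul, smul_eq_mul] }

-- This is `apply_fockResolvent` over the scalars `ℂ⟦X⟧` with `t = X`; there `α i = √(c i) ∑_{k ≥ 1}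
-- (z i X)^k`, and `e` is `1 + weightSeries c z`.
open PowerSeries in
lemma sum_coeff_mul_fockPoisson (c z : Fin s → ℝ) (hc : ∀ i, 0 ≤ c i) (N : ℕ) :
    ∑ k ∈ Finset.range (N + 1), coeff N (X ^ k * (1 + weightSeries c z)⁻¹ ^ (k + 1)) *
      vectorState [] (fockPoisson c z ^ k) = if N = 0 then 1 else 0 := by
  let : Algebra ℂ⟦X⟧ (FockOp s)⟦X⟧ :=
    (scalarSeries (FockOp s)).toAlgebra' fun f g => (scalarSeries_commute f g).eq
  have hsmul : ∀ (f : ℂ⟦X⟧) (g : (FockOp s)⟦X⟧), f • g = scalarSeries (FockOp s) f * g := fun f g => rfl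
  have hE : constantCoeff (1 + weightSeries c z) = 1 := by
    rw [map_add, ← coeff_zero_eq_constantCoeff_apply (weightSeries c z), weightSeries, coeff_mk]
    simp
  obtain ⟨Y, hY, -⟩ := exists_formalResolvent hE (dvd_refl X) (fockPoisson c z)
  have hsc : ∀ a : ℂ, scalarSeries (FockOp s) (C a) = C (algebraMap ℂ (FockOp s) a) := fun a => by
    rw [scalarSeries, map_C]
  let α : Fin s → ℂ⟦X⟧ := fun i => PowerSeries.mk fun k =>
    if k = 0 then 0 else ((√(c i) : ℝ) : ℂ) * (z i : ℂ) ^ k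
  have hα : ∀ i, α i = X * (C (z i : ℂ) * (α i + C ((√(c i) : ℝ) : ℂ))) := by
    intro i
    ext n
    cases n with
    | zero => simp [α]
    | succ n =>
      rw [coeff_succ_X_mul, coeff_C_mul, map_add, coeff_C]
      simp only [α, coeff_mk]
      cases n with
      | zero => simp [mul_comm]
      | succ n => simp; ring
  have he : 1 + weightSeries c z = 1 + ∑ i, α i * C ((√(c i) : ℝ) : ℂ) := by
    congr 1
    ext n
    rw [map_sum]
    simp only [coeff_mul_C, α, weightSeries, coeff_mk]
    split_ifs
    · simp
    · refine Finset.sum_congr rfl fun i _ => ?_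
      have : ((√(c i) : ℝ) : ℂ) * ((√(c i) : ℝ) : ℂ) = c i := by
        rw [← Complex.ofReal_mul, Real.mul_self_sqrt (hc i)]
      rw [← this]
      ring
  have hW0 : constantCoeff (1 - ∑ i, α i • C (creation i) : (FockOp s)⟦X⟧) = ((1 : (FockOp s)ˣ) : FockOp s) := by
    simp only [map_sub, map_sum, hsmul, map_mul, constantCoeff_scalarSeries]
    have : ∀ i, constantCoeff (α i) = 0 := fun i => by
      rw [← coeff_zero_eq_constantCoeff_apply]
      simp [α]
    simp [this]
  have key := apply_fockResolvent (Φ := coeffwise (vectorState ([] : List (Fin s))).toLinearMap)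
    (l := fun i => C (creation i)) (l' := fun i => C (star (creation i)))
    (t := X) (z := fun i => C (z i : ℂ)) (r := fun i => C ((√(c i) : ℝ) : ℂ)) (Y := Y)
    ?_ ?_ ?_ ?_ hα he (mul_invOfUnit _ _ hW0) ?_
  · have := congrArg (coeff N) key
    rw [coeff_one] at this
    rw [← this]
    change _ = coeff N (PowerSeries.mk fun n => vectorState [] (coeff n Y))
    rw [coeff_mk, coeff_formalResolvent hE (dvd_refl X) hY, map_sum]
    exact Finset.sum_congr rfl fun k _ => by rw [map_smul, smul_eq_mul]
  · ext n
    change coeff n (PowerSeries.mk fun n => vectorState [] (coeff n (1 : (FockOp s)⟦X⟧))) = _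
    rw [coeff_mk, coeff_one, coeff_one]
    split_ifs
    · exact (isState_vectorState _).1
    · simp
  · intro i j
    rw [← map_mul, star_creation_mul]
    split_ifs <;> simp
  · intro i x
    ext n
    change coeff n (PowerSeries.mk fun n => vectorState [] (coeff n (C (creation i) * x))) = _
    rw [coeff_mk, coeff_C_mul, vectorState_creation_mul, map_zero]
  · intro i x
    ext n
    change coeff n (PowerSeries.mk fun n => vectorState [] (coeff n (x * C (star (creation i))))) = _
    rw [coeff_mk, coeff_mul_C, vectorState_mul_star_creation, map_zero]
  · refine Eq.trans ?_ hY
    congr 1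
    simp only [hsmul, mul_one, scalarSeries_X, fockPoisson, map_sum, hsc, ← map_mul, ← map_add,
      Algebra.algebraMap_eq_smul_one, smul_mul_assoc, one_mul]

end Fock

/-! ### The moment generating function of the compound free Poisson variable -/

/-- This is `apply_fockResolvent` over `ℂ`, for `t` so small that both inverses are convergent
Neumann series. -/
lemma eventually_hasSum_fockPoisson {s : ℕ} (c z : Fin s → ℝ) (hc : ∀ i, 0 ≤ c i) :
    ∀ᶠ t : ℂ in 𝓝 0, 1 + t * ∑ i, (c i : ℂ) * z i / (1 - t * z i) ≠ 0 ∧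
      HasSum (fun k : ℕ => vectorState [] (fockPoisson c z ^ k) *
        (t / (1 + t * ∑ i, (c i : ℂ) * z i / (1 - t * z i))) ^ k)
        (1 + t * ∑ i, (c i : ℂ) * z i / (1 - t * z i)) := by
  let α : ℂ → Fin s → ℂ := fun t i => t * z i * ((√(c i) : ℝ) : ℂ) / (1 - t * z i)
  let e : ℂ → ℂ := fun t => 1 + t * ∑ i, (c i : ℂ) * z i / (1 - t * z i)
  have hα : ∀ i, ContinuousAt (fun t => α t i) 0 := fun i => by
    refine ContinuousAt.div (by fun_prop) (by fun_prop) (by simp)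
  have he : ContinuousAt e 0 := by
    refine continuousAt_const.add (continuousAt_id.mul (tendsto_finsetSum _ fun i _ => ?_))
    exact ContinuousAt.div (by fun_prop) (by fun_prop) (by simp)
  have he0 : e 0 = 1 := by simp [e]
  have hA : ContinuousAt (fun t => ∑ i, α t i • creation i) 0 :=
    tendsto_finsetSum _ fun i _ => (hα i).smul continuousAt_const
  have hB : ContinuousAt (fun t => (t / e t) • fockPoisson c z) 0 :=
    (continuousAt_id.div he (by simp [he0])).smul continuousAt_const
  have ev1 : ∀ᶠ t : ℂ in 𝓝 0, ∀ i, 1 - t * z i ≠ 0 := by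
    rw [eventually_all]
    intro i
    have : ContinuousAt (fun t : ℂ => 1 - t * z i) 0 := by fun_prop
    exact this.eventually_ne (by simp)
  have ev2 : ∀ᶠ t : ℂ in 𝓝 0, e t ≠ 0 := he.eventually_ne (by simp [he0])
  have ev3 : ∀ᶠ t : ℂ in 𝓝 0, ‖∑ i, α t i • creation i‖ < 1 :=
    hA.norm.eventually_lt_const (by simp [α])
  have ev4 : ∀ᶠ t : ℂ in 𝓝 0, ‖(t / e t) • fockPoisson c z‖ < 1 :=
    hB.norm.eventually_lt_const (by simp)
  filter_upwards [ev1, ev2, ev3, ev4] with t h1 h2 h3 h4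
  refine ⟨h2, ?_⟩
  change HasSum (fun k : ℕ => vectorState [] (fockPoisson c z ^ k) * (t / e t) ^ k) (e t)
  have hsum := (summable_geometric_of_norm_lt_one h4).hasSum
  set V : FockOp s := ∑' k : ℕ, ((t / e t) • fockPoisson c z) ^ k with hV
  have key : (vectorState []).toLinearMap ((e t)⁻¹ • V) = 1 := by
    refine apply_fockResolvent (t := t) (e := e t) (z := fun i => (z i : ℂ))
      (r := fun i => ((√(c i) : ℝ) : ℂ)) (α := α t) (l := creation)
      (l' := fun i => star (creation i)) (isState_vectorState _).1
      star_creation_mul vectorState_creation_mul vectorState_mul_star_creation ?_ ?_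
      (mul_neg_geom_series _ h3) ?_
    · intro i
      have := h1 i
      simp only [α]
      field_simp
      ring
    · simp only [e, α]
      rw [Finset.mul_sum]
      congr 1
      refine Finset.sum_congr rfl fun i _ => ?_
      have : ((√(c i) : ℝ) : ℂ) * ((√(c i) : ℝ) : ℂ) = c i := by
        rw [← Complex.ofReal_mul, Real.mul_self_sqrt (hc i)]
      rw [← this]
      ring
    · have : e t • (1 : FockOp s) - t • ∑ i, (z i : ℂ) • ((creation i + ((√(c i) : ℝ) : ℂ) • 1) *
          (star (creation i) + ((√(c i) : ℝ) : ℂ) • 1)) =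
          e t • (1 - (t / e t) • fockPoisson c z) := by
        rw [smul_sub, smul_smul, mul_div_cancel₀ _ h2]
        rfl
      rw [this, smul_mul_smul_comm, inv_mul_cancel₀ h2, one_smul]
      exact geom_series_mul_neg _ h4
  have h5 : vectorState [] V = e t := by
    have h6 : (e t)⁻¹ * vectorState [] V = 1 := by
      rw [← key]
      exact ((vectorState []).map_smul _ _).symm
    field_simp at h6
    exact h6
  have h6 := hsum.mapL (vectorState [])
  rw [h5] at h6
  convert h6 using 1
  ext k
  rw [smul_pow, map_smul, smul_eq_mul, mul_comm]

/-- The compound free Poisson law, given by its moments and its moment generating function. -/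
lemma exists_freePoisson_measure {s : ℕ} (c z : Fin s → ℝ) (hc : ∀ i, 0 ≤ c i) :
    ∃ μ : Measure ℝ, IsProbabilityMeasure μ ∧ IsCompactlySupported μ ∧
      (∀ N : ℕ, ∑ k ∈ Finset.range (N + 1), PowerSeries.coeff N
        (PowerSeries.X ^ k * (1 + weightSeries c z)⁻¹ ^ (k + 1)) * ((∫ x, x ^ k ∂μ : ℝ) : ℂ) =
          if N = 0 then 1 else 0) ∧
      ∀ᶠ t : ℂ in 𝓝 0, 1 + t * ∑ i, (c i : ℂ) * z i / (1 - t * z i) ≠ 0 ∧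
        momentGenFun μ (t / (1 + t * ∑ i, (c i : ℂ) * z i / (1 - t * z i))) =
          1 + t * ∑ i, (c i : ℂ) * z i / (1 - t * z i) := by
  obtain ⟨μ, h1, h2, h3⟩ := (isState_vectorState ([] : List (Fin s))).exists_isLawOf
    (isSelfAdjoint_fockPoisson c z)
  refine ⟨μ, h1, h2, fun N => ?_, ?_⟩
  · rw [← sum_coeff_mul_fockPoisson c z hc N]
    exact Finset.sum_congr rfl fun k _ => congrArg _ (h3 k).symm
  · filter_upwards [eventually_hasSum_fockPoisson c z hc] with t ht
    refine ⟨ht.1, ?_⟩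
    rw [momentGenFun]
    refine Eq.trans (tsum_congr fun k => ?_) ht.2.tsum_eq
    rw [← h3 k]
    rfl

/-! ### The method of moments for compactly supported limits -/

/-- Along `y ↦ y w` the derivative of each remainder is `w` times the previous one, and `‖exp (y w)‖
= 1` starts the induction. The absence of a factor `e^{‖w‖}` lets a single moment control the error
after integration. -/
lemma Complex.norm_exp_sub_sum_le_of_re_eq_zero {w : ℂ} (hw : w.re = 0) (n : ℕ) :
    ‖Complex.exp w - ∑ m ∈ Finset.range n, w ^ m / m.factorial‖ ≤ ‖w‖ ^ n / n.factorial := by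
  have key : ∀ n : ℕ, ∀ y ∈ Set.Icc (0 : ℝ) 1,
      ‖Complex.exp (y * w) - ∑ m ∈ Finset.range n, (y * w) ^ m / m.factorial‖ ≤
        ‖w‖ ^ n * y ^ n / n.factorial := by
    intro n
    induction n with
    | zero =>
      intro y _
      simp [Complex.norm_exp, hw]
    | succ n ih =>
      have hterm : ∀ (m : ℕ) (y : ℝ), HasDerivAt
          (fun y : ℝ => ((y : ℂ) * w) ^ (m + 1) / ((m + 1).factorial : ℂ))
          (w * (((y : ℂ) * w) ^ m / (m.factorial : ℂ))) y := by
        intro m y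
        have h1 : HasDerivAt (fun y : ℝ => (y : ℂ) * w) w y := by
          simpa using (HasDerivAt.ofReal_comp (hasDerivAt_id y)).mul_const w
        refine ((h1.fun_pow (m + 1)).div_const ((m + 1).factorial : ℂ)).congr_deriv ?_
        rw [Nat.factorial_succ]
        have h3 : (m.factorial : ℂ) ≠ 0 := by exact_mod_cast m.factorial_ne_zero
        have h4 : ((m : ℂ) + 1) ≠ 0 := by exact_mod_cast m.succ_ne_zero
        push_cast
        field_simp
      have hexp : ∀ y : ℝ, HasDerivAt (fun y : ℝ => Complex.exp (y * w))
          (w * Complex.exp (y * w)) y := by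
        intro y
        have h1 : HasDerivAt (fun y : ℝ => (y : ℂ) * w) w y := by
          simpa using (HasDerivAt.ofReal_comp (hasDerivAt_id y)).mul_const w
        simpa [mul_comm] using h1.cexp
      have hderiv : ∀ y : ℝ, HasDerivAt
          (fun y : ℝ => Complex.exp (y * w) -
            ∑ m ∈ Finset.range (n + 1), ((y : ℂ) * w) ^ m / m.factorial)
          (w * (Complex.exp (y * w) -
            ∑ m ∈ Finset.range n, ((y : ℂ) * w) ^ m / m.factorial)) y := by
        intro y
        have h1 := (hexp y).sub ((HasDerivAt.fun_sum fun m (_ : m ∈ Finset.range n) =>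
          hterm m y).add_const 1)
        rw [← Finset.mul_sum, ← mul_sub] at h1
        refine h1.congr_of_eventuallyEq (Eventually.of_forall fun x => ?_)
        simp only [Pi.sub_apply]
        rw [Finset.sum_range_succ']
        simp
      have hB : ∀ y : ℝ, HasDerivAt (fun y : ℝ => ‖w‖ ^ (n + 1) * y ^ (n + 1) / (n + 1).factorial)
          (‖w‖ * (‖w‖ ^ n * y ^ n / n.factorial)) y := by
        intro y
        refine (((hasDerivAt_pow (n + 1) y).const_mul (‖w‖ ^ (n + 1))).div_const
          ((n + 1).factorial : ℝ)).congr_deriv ?_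
        rw [Nat.factorial_succ]
        have h3 : (n.factorial : ℝ) ≠ 0 := by exact_mod_cast n.factorial_ne_zero
        push_cast
        field_simp
        ring
      refine image_norm_le_of_norm_deriv_right_le_deriv_boundary
        (fun y _ => (hderiv y).continuousAt.continuousWithinAt)
        (fun y _ => (hderiv y).hasDerivWithinAt) ?_ hB ?_
      · rw [Finset.sum_range_succ']
        simp
      · intro y hy
        rw [norm_mul]
        exact mul_le_mul_of_nonneg_left (ih y ⟨hy.1, hy.2.le⟩) (norm_nonneg w)
  simpa using key n 1 (by simp)

lemma IsCompactlySupported.exists_ae_abs_le {μ : Measure ℝ} (h : IsCompactlySupported μ) :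
    ∃ C : ℝ, 0 < C ∧ ∀ᵐ x ∂μ, |x| ≤ C := by
  obtain ⟨K, hK, hμ⟩ := h
  obtain ⟨C, hC0, hC⟩ := hK.isBounded.exists_pos_norm_le
  refine ⟨C, hC0, ?_⟩
  filter_upwards [compl_mem_ae_iff.2 hμ] with x hx
  exact hC x (by simpa using hx)

lemma IsCompactlySupported.integrable_pow {μ : Measure ℝ} [IsFiniteMeasure μ]
    (h : IsCompactlySupported μ) (k : ℕ) : Integrable (fun x : ℝ => x ^ k) μ := by
  obtain ⟨C, hC0, hC⟩ := h.exists_ae_abs_le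
  refine Integrable.of_bound (by fun_prop) (C ^ k) ?_
  filter_upwards [hC] with x hx
  rw [norm_pow]
  exact pow_le_pow_left₀ (norm_nonneg x) hx k

lemma IsCompactlySupported.exists_abs_moment_le {μ : Measure ℝ} [IsProbabilityMeasure μ]
    (h : IsCompactlySupported μ) : ∃ C : ℝ, 0 < C ∧ ∀ k : ℕ, |∫ x, x ^ k ∂μ| ≤ C ^ k := by
  obtain ⟨C, hC0, hC⟩ := h.exists_ae_abs_le
  refine ⟨C, hC0, fun k => ?_⟩
  have := norm_integral_le_of_norm_le_const (μ := μ) (f := fun x : ℝ => x ^ k) (C := C ^ k) (by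
    filter_upwards [hC] with x hx
    rw [norm_pow]
    exact pow_le_pow_left₀ (norm_nonneg x) hx k)
  simpa using this

/-- For even `n` the absolute moment in the Taylor bound is the moment itself. -/
lemma norm_charFun_sub_sum_moment_le {μ : Measure ℝ} [IsProbabilityMeasure μ]
    (h : IsCompactlySupported μ) (t : ℝ) {n : ℕ} (hn : Even n) :
    ‖charFun μ t - ∑ m ∈ Finset.range n,
      (t * Complex.I) ^ m / m.factorial * ((∫ x, x ^ m ∂μ : ℝ) : ℂ)‖ ≤
      |t| ^ n / n.factorial * ∫ x, x ^ n ∂μ := by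
  have hint : ∀ m : ℕ, Integrable
      (fun x : ℝ => (t * Complex.I) ^ m / m.factorial * ((x ^ m : ℝ) : ℂ)) μ := fun m =>
    (h.integrable_pow m).ofReal.const_mul _
  have hexp : Integrable (fun x : ℝ => Complex.exp (t * x * Complex.I)) μ := by
    refine Integrable.of_bound (by fun_prop) 1 (ae_of_all _ fun x => ?_)
    simp [Complex.norm_exp]
  have hsum : ∑ m ∈ Finset.range n,
      (t * Complex.I) ^ m / m.factorial * ((∫ x, x ^ m ∂μ : ℝ) : ℂ) =
      ∫ x : ℝ, ∑ m ∈ Finset.range n,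
        (t * Complex.I) ^ m / m.factorial * ((x ^ m : ℝ) : ℂ) ∂μ := by
    rw [integral_finsetSum _ fun m _ => hint m]
    refine Finset.sum_congr rfl fun m _ => ?_
    rw [integral_const_mul, integral_complex_ofReal]
  rw [charFun_apply_real, hsum, ← integral_sub hexp (integrable_finsetSum _ fun m _ => hint m),
    ← integral_const_mul]
  refine norm_integral_le_of_norm_le ((h.integrable_pow n).const_mul _) (ae_of_all _ fun x => ?_)
  have := Complex.norm_exp_sub_sum_le_of_re_eq_zero (w := t * x * Complex.I) (by simp) n
  have e1 : ∑ m ∈ Finset.range n, (t * Complex.I) ^ m / m.factorial * ((x ^ m : ℝ) : ℂ) =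
      ∑ m ∈ Finset.range n, (t * x * Complex.I) ^ m / m.factorial := by
    refine Finset.sum_congr rfl fun m _ => ?_
    push_cast
    ring
  have e2 : ‖(t * x * Complex.I : ℂ)‖ ^ n / n.factorial = |t| ^ n / n.factorial * x ^ n := by
    rw [norm_mul, norm_mul, Complex.norm_I, mul_one, Complex.norm_real, Complex.norm_real,
      mul_pow, Real.norm_eq_abs, Real.norm_eq_abs, hn.pow_abs x]
    ring
  rw [e1, ← e2]
  exact this

/-- Convergence of moments to those of a compactly supported measure implies weak convergence. -/
lemma tendsto_of_tendsto_moment {P : ℕ → ProbabilityMeasure ℝ} {π : ProbabilityMeasure ℝ}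
    (hP : ∀ᶠ n in atTop, IsCompactlySupported (P n : Measure ℝ))
    (hπ : IsCompactlySupported (π : Measure ℝ))
    (h : ∀ k : ℕ, Tendsto (fun n => ∫ x, x ^ k ∂(P n : Measure ℝ)) atTop
      (𝓝 (∫ x, x ^ k ∂(π : Measure ℝ)))) : Tendsto P atTop (𝓝 π) := by
  rw [ProbabilityMeasure.tendsto_iff_tendsto_charFun]
  intro t
  obtain ⟨C, hC0, hC⟩ := hπ.exists_abs_moment_le
  rw [Metric.tendsto_nhds]
  intro ε hε
  have hlim : Tendsto (fun N : ℕ => (|t| * C) ^ N / N.factorial) atTop (𝓝 0) :=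
    FloorSemiring.tendsto_pow_div_factorial_atTop _
  -- `N` depends only on the limit law. Convergence of the `N`-th moment carries the error bound
  -- over to `P n`, so no common support is needed.
  obtain ⟨N, hN, hNe⟩ : ∃ N : ℕ, (|t| * C) ^ N / N.factorial < ε / 4 ∧ Even N := by
    obtain ⟨N₀, hN₀⟩ := eventually_atTop.1 (hlim.eventually_lt_const (by positivity : 0 < ε / 4))
    exact ⟨2 * N₀, hN₀ _ (by omega), even_two_mul N₀⟩
  have hπN : |t| ^ N / N.factorial * ∫ x, x ^ N ∂(π : Measure ℝ) < ε / 4 := by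
    refine lt_of_le_of_lt ?_ hN
    rw [mul_pow, mul_div_right_comm]
    exact mul_le_mul_of_nonneg_left ((le_abs_self _).trans (hC N)) (by positivity)
  have hPN : ∀ᶠ n in atTop, |t| ^ N / N.factorial * ∫ x, x ^ N ∂(P n : Measure ℝ) < ε / 4 :=
    ((h N).const_mul _).eventually_lt_const hπN
  have hsum : Tendsto (fun n => ∑ m ∈ Finset.range N,
      (t * Complex.I) ^ m / m.factorial * ((∫ x, x ^ m ∂(P n : Measure ℝ) : ℝ) : ℂ)) atTop
      (𝓝 (∑ m ∈ Finset.range N,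
        (t * Complex.I) ^ m / m.factorial * ((∫ x, x ^ m ∂(π : Measure ℝ) : ℝ) : ℂ))) :=
    tendsto_finsetSum _ fun m _ =>
      ((Complex.continuous_ofReal.tendsto _).comp (h m)).const_mul _
  filter_upwards [hP, hPN, Metric.tendsto_nhds.1 hsum (ε / 4) (by positivity)] with n h1 h2 h3
  have h4 := norm_charFun_sub_sum_moment_le h1 t hNe
  have h5 := norm_charFun_sub_sum_moment_le hπ t hNe
  rw [dist_eq_norm] at h3 ⊢
  rw [← sub_add_sub_cancel (charFun (P n : Measure ℝ) t) (∑ m ∈ Finset.range N,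
      (t * Complex.I) ^ m / m.factorial * ((∫ x, x ^ m ∂(P n : Measure ℝ) : ℝ) : ℂ)),
    ← sub_add_sub_cancel (∑ m ∈ Finset.range N,
      (t * Complex.I) ^ m / m.factorial * ((∫ x, x ^ m ∂(P n : Measure ℝ) : ℝ) : ℂ))
      (∑ m ∈ Finset.range N,
        (t * Complex.I) ^ m / m.factorial * ((∫ x, x ^ m ∂(π : Measure ℝ) : ℝ) : ℂ))]
  refine (norm_add_le _ _).trans_lt ?_
  have h6 := norm_add_le (∑ m ∈ Finset.range N,
      (t * Complex.I) ^ m / m.factorial * ((∫ x, x ^ m ∂(P n : Measure ℝ) : ℝ) : ℂ) -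
      ∑ m ∈ Finset.range N,
        (t * Complex.I) ^ m / m.factorial * ((∫ x, x ^ m ∂(π : Measure ℝ) : ℝ) : ℂ))
    (∑ m ∈ Finset.range N,
        (t * Complex.I) ^ m / m.factorial * ((∫ x, x ^ m ∂(π : Measure ℝ) : ℝ) : ℂ) -
      charFun (π : Measure ℝ) t)
  rw [norm_sub_rev _ (charFun (π : Measure ℝ) t)] at h6
  linarith

/-- Solutions of unitriangular linear systems depend continuously on the coefficients. -/
lemma tendsto_of_unitriangular {a : ℕ → ℕ → ℕ → ℂ} {a₀ : ℕ → ℕ → ℂ} {b : ℕ → ℂ} {m : ℕ → ℕ → ℂ}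
    {m₀ : ℕ → ℂ} (ha : ∀ N k, Tendsto (fun n => a n N k) atTop (𝓝 (a₀ N k)))
    (ha1 : ∀ᶠ n in atTop, ∀ N, a n N N = 1) (ha01 : ∀ N, a₀ N N = 1)
    (hm : ∀ᶠ n in atTop, ∀ N, ∑ k ∈ Finset.range (N + 1), a n N k * m n k = b N)
    (hm₀ : ∀ N, ∑ k ∈ Finset.range (N + 1), a₀ N k * m₀ k = b N) (N : ℕ) :
    Tendsto (fun n => m n N) atTop (𝓝 (m₀ N)) := by
  induction N using Nat.strong_induction_on with
  | _ N ih =>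
  have h0 : m₀ N = b N - ∑ k ∈ Finset.range N, a₀ N k * m₀ k := by
    rw [← hm₀ N, Finset.sum_range_succ, ha01]
    ring
  have h1 : (fun n => m n N) =ᶠ[atTop] fun n => b N - ∑ k ∈ Finset.range N, a n N k * m n k := by
    filter_upwards [ha1, hm] with n h1 h2
    rw [← h2 N, Finset.sum_range_succ, h1]
    ring
  rw [h0, tendsto_congr' h1]
  exact tendsto_const_nhds.sub (tendsto_finsetSum _ fun k hk =>
    (ha N k).mul (ih k (Finset.mem_range.1 hk)))

/-! ### Finitely supported measures -/

lemma integral_sum_ofReal_smul_dirac {m : ℕ} {E : Type} [NormedAddCommGroup E] [NormedSpace ℝ E]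
    [CompleteSpace E] (p d : Fin m → ℝ) (hp : ∀ j, 0 ≤ p j) (f : ℝ → E) :
    ∫ x, f x ∂(∑ j, ENNReal.ofReal (p j) • Measure.dirac (d j)) = ∑ j, p j • f (d j) := by
  rw [integral_finsetSum_measure fun j _ =>
    (integrable_dirac (by simp)).smul_measure ENNReal.ofReal_ne_top]
  refine Finset.sum_congr rfl fun j _ => ?_
  rw [integral_smul_measure, integral_dirac, ENNReal.toReal_ofReal (hp j)]

section PoissonStep

variable {s : ℕ} (c z : Fin s → ℝ)

lemma discreteMeasure_real_univ (hc : ∀ i, 0 ≤ c i) :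
    (discreteMeasure c z).real Set.univ = ∑ i, c i := by
  rw [measureReal_def, discreteMeasure]
  simp only [Measure.coe_finsetSum, Finset.sum_apply, Measure.smul_apply, measure_univ,
    smul_eq_mul, mul_one]
  rw [← ENNReal.ofReal_sum_of_nonneg fun j _ => hc j,
    ENNReal.toReal_ofReal (Finset.sum_nonneg fun i _ => hc i)]

/-- The weights of the atoms of `poissonStep`. -/
def stepWeight (n : ℕ) : Fin (s + 1) → ℝ := Fin.cons (1 - (∑ i, c i) / n) fun i => c i / n

/-- The atoms of `poissonStep`. -/
def stepAtom : Fin (s + 1) → ℝ := Fin.cons 0 z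

variable {c}

lemma stepWeight_nonneg (hc : ∀ i, 0 ≤ c i) {n : ℕ} (hn : 0 < n) (hn' : ∑ i, c i ≤ n)
    (j : Fin (s + 1)) : 0 ≤ stepWeight c n j := by
  have hn0 : (0 : ℝ) < n := by exact_mod_cast hn
  refine Fin.cases ?_ (fun i => ?_) j
  · simp only [stepWeight, Fin.cons_zero, sub_nonneg]
    rwa [div_le_one hn0]
  · simp only [stepWeight, Fin.cons_succ]
    exact div_nonneg (hc i) hn0.le

lemma sum_stepWeight (n : ℕ) : ∑ j, stepWeight c n j = 1 := by
  rw [Fin.sum_univ_succ]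
  simp [stepWeight, Finset.sum_div]

lemma poissonStep_discreteMeasure (hc : ∀ i, 0 ≤ c i) (n : ℕ) :
    poissonStep (discreteMeasure c z) n =
      ∑ j, ENNReal.ofReal (stepWeight c n j) • Measure.dirac (stepAtom z j) := by
  rw [poissonStep, discreteMeasure_real_univ c z hc, Fin.sum_univ_succ, discreteMeasure,
    Finset.smul_sum]
  simp only [stepWeight, stepAtom, Fin.cons_zero, Fin.cons_succ]
  congr 1
  refine Finset.sum_congr rfl fun i _ => ?_
  rw [smul_smul, ← ENNReal.ofReal_mul (by positivity)]
  congr 2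
  ring

lemma integral_poissonStep {E : Type} [NormedAddCommGroup E] [NormedSpace ℝ E]
    [CompleteSpace E] (hc : ∀ i, 0 ≤ c i) {n : ℕ} (hn : 0 < n) (hn' : ∑ i, c i ≤ n) (f : ℝ → E) :
    ∫ x, f x ∂(poissonStep (discreteMeasure c z) n) =
      (1 - (∑ i, c i) / n) • f 0 + ∑ i, (c i / n) • f (z i) := by
  rw [poissonStep_discreteMeasure z hc,
    integral_sum_ofReal_smul_dirac _ _ (stepWeight_nonneg hc hn hn'), Fin.sum_univ_succ]
  simp only [stepWeight, stepAtom, Fin.cons_zero, Fin.cons_succ]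

lemma isProbabilityMeasure_poissonStep (hc : ∀ i, 0 ≤ c i) {n : ℕ} (hn : 0 < n)
    (hn' : ∑ i, c i ≤ n) : IsProbabilityMeasure (poissonStep (discreteMeasure c z) n) := by
  constructor
  rw [poissonStep_discreteMeasure z hc]
  simp only [Measure.coe_finsetSum, Finset.sum_apply, Measure.smul_apply, measure_univ,
    smul_eq_mul, mul_one]
  rw [← ENNReal.ofReal_sum_of_nonneg fun j _ => stepWeight_nonneg hc hn hn' j, sum_stepWeight,
    ENNReal.ofReal_one]

/-- The atom at `0` only affects the zeroth moment. Consequently `n (M - 1)` is independent of `n`.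
-/
lemma momentSeries_poissonStep (hc : ∀ i, 0 ≤ c i) {n : ℕ} (hn : 0 < n) (hn' : ∑ i, c i ≤ n) :
    momentSeries (poissonStep (discreteMeasure c z) n) =
      1 + PowerSeries.C (n : ℂ)⁻¹ * weightSeries c z := by
  ext k
  rw [momentSeries, PowerSeries.coeff_mk, integral_poissonStep z hc hn hn', map_add,
    PowerSeries.coeff_C_mul, weightSeries, PowerSeries.coeff_mk, PowerSeries.coeff_one]
  by_cases hk : k = 0
  · subst hk
    simp [Finset.sum_div]
  · simp only [smul_eq_mul, zero_pow hk, mul_zero, zero_add, if_neg hk]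
    push_cast
    rw [Finset.mul_sum]
    exact Finset.sum_congr rfl fun i _ => by ring

lemma charFun_poissonStep (hc : ∀ i, 0 ≤ c i) {n : ℕ} (hn : 0 < n) (hn' : ∑ i, c i ≤ n) (t : ℝ) :
    charFun (poissonStep (discreteMeasure c z) n) t =
      1 + (∑ i, (c i : ℂ) * (Complex.exp (t * z i * Complex.I) - 1)) / n := by
  rw [charFun_apply_real, integral_poissonStep z hc hn hn']
  simp only [Complex.real_smul, mul_sub, Finset.sum_sub_distrib, sub_div, Finset.sum_div]
  push_cast
  simp only [mul_zero, zero_mul, Complex.exp_zero, mul_one, div_mul_eq_mul_div]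
  ring

variable (c) in
lemma eventually_sum_le : ∀ᶠ n : ℕ in atTop, 0 < n ∧ ∑ i, c i ≤ n :=
  (eventually_gt_atTop 0).and (tendsto_natCast_atTop_atTop.eventually_ge_atTop _)

/-! ### The compound Poisson law -/

lemma isProbabilityMeasure_convPow {μ : Measure ℝ} (hμ : IsProbabilityMeasure μ) (n : ℕ) :
    IsProbabilityMeasure (convPow μ n) := by
  induction n with
  | zero => exact Measure.dirac.isProbabilityMeasure
  | succ n ih =>
    rw [convPow]
    infer_instance

lemma charFun_convPow {μ : Measure ℝ} (hμ : IsProbabilityMeasure μ) (n : ℕ) (t : ℝ) :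
    charFun (convPow μ n) t = charFun μ t ^ n := by
  induction n with
  | zero => simp [convPow, charFun_dirac]
  | succ n ih =>
    have := isProbabilityMeasure_convPow hμ n
    rw [convPow, charFun_conv, ih, pow_succ]

lemma tendsto_charFun_convPow_poissonStep (hc : ∀ i, 0 ≤ c i) (t : ℝ) :
    Tendsto (fun n => charFun (convPow (poissonStep (discreteMeasure c z) n) n) t) atTop
      (𝓝 (Complex.exp (∑ i, (c i : ℂ) * (Complex.exp (t * z i * Complex.I) - 1)))) := by
  refine (Complex.tendsto_one_add_div_pow_exp _).congr' ?_
  filter_upwards [eventually_sum_le c] with n hn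
  rw [charFun_convPow (isProbabilityMeasure_poissonStep z hc hn.1 hn.2),
    charFun_poissonStep z hc hn.1 hn.2]

-- Supplies the limit measure: the convolution of the laws of `z i` times a Poisson variable of
-- parameter `c i`.
variable (c) in
lemma exists_charFun_eq_exp (hc : ∀ i, 0 ≤ c i) : ∃ p : ProbabilityMeasure ℝ, ∀ t : ℝ,
    charFun (p : Measure ℝ) t =
      Complex.exp (∑ i, (c i : ℂ) * (Complex.exp (t * z i * Complex.I) - 1)) := by
  induction s with
  | zero => exact ⟨⟨Measure.dirac 0, inferInstance⟩, fun t => by simp [charFun_dirac]⟩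
  | succ s ih =>
    obtain ⟨p, hp⟩ := ih (fun i => z i.succ) (c := fun i => c i.succ) fun i => hc _
    let q : Measure ℝ := ((ProbabilityTheory.poissonMeasure (c 0).toNNReal).map
      (Nat.cast : ℕ → ℝ)).map (z 0 * ·)
    have hq : IsProbabilityMeasure q :=
      Measure.isProbabilityMeasure_map (by fun_prop)
    refine ⟨⟨q.conv p, inferInstance⟩, fun t => ?_⟩
    change charFun (q.conv p) t = _
    rw [charFun_conv, hp, charFun_map_mul, ProbabilityTheory.charFun_map_cast_poissonMeasure,
      ← Complex.exp_add, Fin.sum_univ_succ]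
    have h0 : (((c 0).toNNReal : ℝ) : ℂ) = c 0 := by rw [Real.coe_toNNReal _ (hc 0)]
    rw [h0]
    congr 4
    push_cast
    ring_nf

lemma IsCompoundPoissonLaw.charFun_eq (hc : ∀ i, 0 ≤ c i) {p : ProbabilityMeasure ℝ}
    (hp : IsCompoundPoissonLaw (discreteMeasure c z) p) (t : ℝ) :
    charFun (p : Measure ℝ) t =
      Complex.exp (∑ i, (c i : ℂ) * (Complex.exp (t * z i * Complex.I) - 1)) := by
  obtain ⟨P, hP, hlim⟩ := hp
  refine tendsto_nhds_unique (ProbabilityMeasure.tendsto_iff_tendsto_charFun.1 hlim t) ?_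
  refine (tendsto_charFun_convPow_poissonStep z hc t).congr' ?_
  filter_upwards [hP] with n hn
  rw [hn]

variable (c) in
lemma existsUnique_isCompoundPoissonLaw (hc : ∀ i, 0 ≤ c i) :
    ∃! p : ProbabilityMeasure ℝ, IsCompoundPoissonLaw (discreteMeasure c z) p := by
  obtain ⟨p, hp⟩ := exists_charFun_eq_exp c z hc
  refine ⟨p, ?_, fun q hq => ?_⟩
  · have hex : ∀ n : ℕ, ∃ P : ProbabilityMeasure ℝ, (0 < n ∧ ∑ i, c i ≤ n) →
        (P : Measure ℝ) = convPow (poissonStep (discreteMeasure c z) n) n := by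
      intro n
      by_cases hn : 0 < n ∧ ∑ i, c i ≤ n
      · exact ⟨⟨_, isProbabilityMeasure_convPow
          (isProbabilityMeasure_poissonStep z hc hn.1 hn.2) n⟩, fun _ => rfl⟩
      -- A filler for the finitely many `n` outside the range where the step is a probability
      -- measure.
      · exact ⟨p, fun h => absurd h hn⟩
    choose P hP using hex
    have hPe : ∀ᶠ n in atTop, (P n : Measure ℝ) =
        convPow (poissonStep (discreteMeasure c z) n) n := (eventually_sum_le c).mono hP
    refine ⟨P, hPe, ProbabilityMeasure.tendsto_iff_tendsto_charFun.2 fun t => ?_⟩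
    rw [hp]
    refine (tendsto_charFun_convPow_poissonStep z hc t).congr' ?_
    filter_upwards [hPe] with n hn
    rw [hn]
  · have : (q : Measure ℝ) = (p : Measure ℝ) := Measure.ext_of_charFun
      (funext fun t => (hq.charFun_eq z hc t).trans (hp t).symm)
    exact Subtype.ext this

lemma fourierTransform_eq_charFun (μ : Measure ℝ) (y : ℝ) :
    fourierTransform μ y = charFun μ (-y) := by
  rw [fourierTransform, charFun_apply_real]
  refine integral_congr_ae (ae_of_all _ fun x => ?_)
  push_cast
  ring_nf

/-! ### The compound free Poisson law -/

-- Both systems involve the same `E = 1 + weightSeries c z`. Their coefficients are values at `1/n`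
-- and at `0` of one continuous function of a parameter `a`, so the solutions converge.
open PowerSeries in
lemma tendsto_moment_of_isFreeConvPow (hc : ∀ i, 0 ≤ c i) {P : ℕ → ProbabilityMeasure ℝ}
    (hP : ∀ᶠ n in atTop, IsFreeConvPow (poissonStep (discreteMeasure c z) n) n (P n : Measure ℝ))
    {m : ℕ → ℂ} (hm : ∀ N : ℕ, ∑ k ∈ Finset.range (N + 1), coeff N
        (X ^ k * (1 + weightSeries c z)⁻¹ ^ (k + 1)) * m k = if N = 0 then 1 else 0) (N : ℕ) :
    Tendsto (fun n => ((∫ x, x ^ N ∂(P n : Measure ℝ) : ℝ) : ℂ)) atTop (𝓝 (m N)) := by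
  have hw0 : constantCoeff (weightSeries c z) = 0 := by
    rw [← coeff_zero_eq_constantCoeff_apply, weightSeries, coeff_mk, if_pos rfl]
  have hone : ∀ (a : ℂ) (k : ℕ), coeff k ((X * (1 + C a * weightSeries c z)) ^ k *
      (1 + weightSeries c z)⁻¹ ^ (k + 1)) = 1 := by
    intro a k
    rw [mul_pow, mul_assoc, coeff_X_pow_mul', if_pos le_rfl, Nat.sub_self,
      coeff_zero_eq_constantCoeff_apply]
    simp [hw0]
  refine tendsto_of_unitriangular
    (a := fun n N k => coeff N ((X * (1 + C (n : ℂ)⁻¹ * weightSeries c z)) ^ k *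
      (1 + weightSeries c z)⁻¹ ^ (k + 1)))
    (m := fun n k => ((∫ x, x ^ k ∂(P n : Measure ℝ) : ℝ) : ℂ))
    (fun N k => ?_) (Eventually.of_forall fun n N => hone _ N) (fun N => ?_) ?_ hm N
  · open scoped PowerSeries.WithPiTopology in
    have h0 : Tendsto (fun n : ℕ => (n : ℂ)⁻¹) atTop (𝓝 0) :=
      tendsto_inv_atTop_nhds_zero_nat
    have hcont : Continuous fun a : ℂ => coeff N ((X * (1 + C a * weightSeries c z)) ^ k *
        (1 + weightSeries c z)⁻¹ ^ (k + 1)) := by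
      refine (PowerSeries.WithPiTopology.continuous_coeff ℂ N).comp ?_
      have := PowerSeries.WithPiTopology.continuous_C (R := ℂ)
      fun_prop
    have := (hcont.tendsto 0).comp h0
    simpa [Function.comp_def] using this
  · simpa using hone 0 N
  · filter_upwards [hP, eventually_sum_le c] with n h hn N
    have := h.sum_coeff_mul_moment (isProbabilityMeasure_poissonStep z hc hn.1 hn.2) N
    rw [momentSeries_poissonStep z hc hn.1 hn.2] at this
    have hn0 : (n : ℂ) ≠ 0 := by exact_mod_cast hn.1.ne'
    have e : (n : PowerSeries ℂ) * (1 + C (n : ℂ)⁻¹ * weightSeries c z - 1) = weightSeries c z := by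
      rw [add_sub_cancel_left, ← mul_assoc, ← map_natCast (C (R := ℂ)) n, ← map_mul,
        mul_inv_cancel₀ hn0, map_one, one_mul]
    rwa [e] at this

end PoissonStep

/-- Quantifying over every admissible sequence gives existence and uniqueness of the limit at once,
with no separate uniqueness proof for free convolution powers. -/
lemma exists_limit_isFreeConvPow {s : ℕ} (c z : Fin s → ℝ) (hc : ∀ i, 0 ≤ c i) :
    ∃ π : ProbabilityMeasure ℝ, IsCompactlySupported (π : Measure ℝ) ∧
      (∀ᶠ t : ℂ in 𝓝 0, 1 + t * ∑ i, (c i : ℂ) * z i / (1 - t * z i) ≠ 0 ∧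
        momentGenFun (π : Measure ℝ) (t / (1 + t * ∑ i, (c i : ℂ) * z i / (1 - t * z i))) =
          1 + t * ∑ i, (c i : ℂ) * z i / (1 - t * z i)) ∧
      ∀ P : ℕ → ProbabilityMeasure ℝ, (∀ᶠ n in atTop,
        IsFreeConvPow (poissonStep (discreteMeasure c z) n) n (P n : Measure ℝ)) →
          Tendsto P atTop (𝓝 π) := by
  obtain ⟨μ, hμ, hcs, hm, hG⟩ := exists_freePoisson_measure c z hc
  refine ⟨⟨μ, hμ⟩, hcs, hG, fun P hP => ?_⟩
  refine tendsto_of_tendsto_moment (hP.mono fun n hn => ?_) hcs fun k => ?_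
  · obtain ⟨A, _, φ, a, -, -, -, -, hS⟩ := hn
    exact hS.2.1
  · exact (Complex.continuous_re.tendsto _).comp (tendsto_moment_of_isFreeConvPow z hc hP hm k)

lemma exists_eventually_isFreeConvPow {s : ℕ} (c z : Fin s → ℝ) (hc : ∀ i, 0 ≤ c i) :
    ∃ P : ℕ → ProbabilityMeasure ℝ, ∀ᶠ n in atTop,
      IsFreeConvPow (poissonStep (discreteMeasure c z) n) n (P n : Measure ℝ) := by
  have hex : ∀ n : ℕ, ∃ P : ProbabilityMeasure ℝ, (0 < n ∧ ∑ i, c i ≤ n) →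
      IsFreeConvPow (poissonStep (discreteMeasure c z) n) n (P : Measure ℝ) := by
    intro n
    by_cases hn : 0 < n ∧ ∑ i, c i ≤ n
    · obtain ⟨τ, hτ⟩ := exists_isFreeConvPow (stepWeight c n) (stepAtom z)
        (stepWeight_nonneg hc hn.1 hn.2) (sum_stepWeight n) n
      rw [← poissonStep_discreteMeasure z hc] at hτ
      have hprob : IsProbabilityMeasure τ := by
        obtain ⟨A, _, φ, a, -, -, -, -, hS⟩ := hτ
        exact hS.1
      exact ⟨⟨τ, hprob⟩, fun _ => hτ⟩
    · exact ⟨⟨Measure.dirac 0, inferInstance⟩, fun h => absurd h hn⟩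
  choose P hP using hex
  exact ⟨P, (eventually_sum_le c).mono hP⟩

/-! ### Uniqueness of the R-transform -/

lemma analyticAt_momentGenFun {μ : Measure ℝ} [IsProbabilityMeasure μ]
    (h : IsCompactlySupported μ) : AnalyticAt ℂ (momentGenFun μ) 0 := by
  obtain ⟨C, hC0, hC⟩ := h.exists_abs_moment_le
  have hU : Metric.ball (0 : ℂ) (2 * C)⁻¹ ∈ 𝓝 (0 : ℂ) := Metric.ball_mem_nhds _ (by positivity)
  refine DifferentiableOn.analyticAt (s := Metric.ball (0 : ℂ) (2 * C)⁻¹) ?_ hU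
  refine Complex.differentiableOn_tsum_of_summable_norm (u := fun k : ℕ => (1 / 2 : ℝ) ^ k)
    summable_geometric_two (fun k => by fun_prop) Metric.isOpen_ball fun k w hw => ?_
  rw [mem_ball_zero_iff] at hw
  rw [norm_mul, norm_pow, Complex.norm_real, Real.norm_eq_abs]
  calc |∫ x, x ^ k ∂μ| * ‖w‖ ^ k ≤ C ^ k * ((2 * C)⁻¹) ^ k := by
        gcongr
        exact hC k
    _ = (1 / 2 : ℝ) ^ k := by
        rw [← mul_pow]
        congr 1
        field_simp

lemma hasStrictDerivAt_mul_momentGenFun {μ : Measure ℝ} [IsProbabilityMeasure μ]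
    (h : IsCompactlySupported μ) :
    HasStrictDerivAt (fun t : ℂ => t * momentGenFun μ t) 1 0 := by
  have h0 : momentGenFun μ 0 = 1 := by
    rw [momentGenFun, tsum_eq_single 0 fun k hk => by simp [hk]]
    simp
  have h1 := (hasStrictDerivAt_id (0 : ℂ)).mul (analyticAt_momentGenFun h).hasStrictDerivAt
  refine h1.congr_deriv ?_
  simp [h0]

lemma tendsto_inv_add_inv {R : ℂ → ℂ} (hR : ContinuousAt R 0) :
    Tendsto (fun y => (R y + y⁻¹)⁻¹) (𝓝[≠] 0) (𝓝 0) := by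
  have h1 : Tendsto (fun y => y / (1 + y * R y)) (𝓝 0) (𝓝 0) := by
    have : ContinuousAt (fun y => y / (1 + y * R y)) 0 :=
      continuousAt_id.div (continuousAt_const.add (continuousAt_id.mul hR)) (by simp)
    simpa using this.tendsto
  refine (h1.mono_left nhdsWithin_le_nhds).congr' ?_
  filter_upwards [self_mem_nhdsWithin] with y hy
  have hy0 : y ≠ 0 := hy
  rw [← inv_div]
  congr 1
  field_simp
  ring

/-- With `g(t) = t f(t)`, the defining equation reads `g(1/K(y)) = y`. Since `g'(0) = 1` and `1/K(y)
→ 0`, `1/K` must be the local inverse of `g`. This fixes `R` off `0`, and analyticity extends the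
equality to `0`. -/
lemma IsRTransform.eventuallyEq {μ : Measure ℝ} [IsProbabilityMeasure μ] {R R' : ℂ → ℂ}
    (hR : IsRTransform μ R) (hR' : IsRTransform μ R') : R =ᶠ[𝓝 0] R' := by
  have hg := hasStrictDerivAt_mul_momentGenFun hR.1
  have hinj := hg.eventually_left_inverse one_ne_zero
  have key : ∀ {Q : ℂ → ℂ}, IsRTransform μ Q → ∀ᶠ y in 𝓝[≠] (0 : ℂ),
      hg.localInverse _ _ _ one_ne_zero y = (Q y + y⁻¹)⁻¹ := by
    intro Q hQ
    filter_upwards [hQ.2.2, (tendsto_inv_add_inv hQ.2.1.continuousAt).eventually hinj]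
      with y h1 h2
    rw [cauchyTransform] at h1
    rw [h1] at h2
    exact h2
  refine (hR.2.1.frequently_eq_iff_eventually_eq hR'.2.1).1 (Eventually.frequently ?_)
  filter_upwards [key hR, key hR'] with y h1 h2
  rw [h1] at h2
  exact add_right_cancel (inv_inj.1 h2)

/-- With `e = 1 + y R(y)` one has `1/K(y) = y/e`, so `G(K(y)) = (y/e) f(y/e) = (y/e) e = y`. -/
lemma isRTransform_freePoisson {s : ℕ} {c z : Fin s → ℝ} {μ : Measure ℝ}
    (hcs : IsCompactlySupported μ)
    (h : ∀ᶠ t : ℂ in 𝓝 0, 1 + t * ∑ i, (c i : ℂ) * z i / (1 - t * z i) ≠ 0 ∧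
      momentGenFun μ (t / (1 + t * ∑ i, (c i : ℂ) * z i / (1 - t * z i))) =
        1 + t * ∑ i, (c i : ℂ) * z i / (1 - t * z i)) :
    IsRTransform μ fun y : ℂ => ∑ i, (c i : ℂ) * z i / (1 - y * z i) := by
  refine ⟨hcs, ?_, ?_⟩
  · refine Finset.analyticAt_fun_sum _ fun i _ => ?_
    exact AnalyticAt.div (by fun_prop) (by fun_prop) (by simp)
  · filter_upwards [h.filter_mono nhdsWithin_le_nhds, self_mem_nhdsWithin] with y hy hy0
    have hy0' : y ≠ 0 := hy0
    have e : (∑ i, (c i : ℂ) * z i / (1 - y * z i) + y⁻¹)⁻¹ =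
        y / (1 + y * ∑ i, (c i : ℂ) * z i / (1 - y * z i)) := by
      rw [← inv_div]
      congr 1
      field_simp
      ring_nf
    rw [cauchyTransform, e, hy.2, div_mul_cancel₀ _ hy.1]

end

theorem lemma4p3 (s : ℕ) (c z : Fin s → ℝ) (hc : ∀ i, 0 < c i) :
    (∃! p : ProbabilityMeasure ℝ, IsCompoundPoissonLaw (discreteMeasure c z) p) ∧
    (∃! π : ProbabilityMeasure ℝ, IsCompoundFreePoissonLaw (discreteMeasure c z) π) ∧
    (∀ p : ProbabilityMeasure ℝ, IsCompoundPoissonLaw (discreteMeasure c z) p →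
      ∀ y : ℝ, fourierTransform (p : Measure ℝ) y =
        Complex.exp (∑ i, (c i : ℂ) * (Complex.exp (-Complex.I * y * z i) - 1))) ∧
    (∀ π : ProbabilityMeasure ℝ, IsCompoundFreePoissonLaw (discreteMeasure c z) π →
      ∀ R : ℂ → ℂ, IsRTransform (π : Measure ℝ) R ↔
        R =ᶠ[𝓝 0] fun y : ℂ => ∑ i, (c i : ℂ) * z i / (1 - y * z i)) := by
  have hc0 : ∀ i, 0 ≤ c i := fun i => (hc i).le
  obtain ⟨π₀, hcs, hG, hlim⟩ := exists_limit_isFreeConvPow c z hc0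
  obtain ⟨P, hP⟩ := exists_eventually_isFreeConvPow c z hc0
  have huniq : ∀ π : ProbabilityMeasure ℝ,
      IsCompoundFreePoissonLaw (discreteMeasure c z) π → π = π₀ := by
    rintro π ⟨Q, hQ, hQlim⟩
    exact tendsto_nhds_unique hQlim (hlim Q hQ)
  refine ⟨existsUnique_isCompoundPoissonLaw c z hc0, ⟨π₀, ⟨P, hP, hlim P hP⟩, huniq⟩, ?_, ?_⟩
  · intro p hp y
    rw [fourierTransform_eq_charFun, hp.charFun_eq z hc0]
    push_cast
    congr 1
    refine Finset.sum_congr rfl fun i _ => ?_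
    ring_nf
  · intro π hπ R
    obtain rfl := huniq π hπ
    have hR₀ := isRTransform_freePoisson hcs hG
    refine ⟨fun hR => hR.eventuallyEq hR₀, fun hR => ⟨hcs, hR₀.2.1.congr hR.symm, ?_⟩⟩
    filter_upwards [hR₀.2.2, hR.filter_mono nhdsWithin_le_nhds] with y h1 h2
    rw [h2]
    exact h1
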